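/- **Model.** Let $k\ge 2$, $d\ge 1$, $\theta_1,\dots,\theta_k\in\mathbb R^d$, labels $z\in[k]^n$, and $Y_i=\theta_{z_i}+w_i$ for $i\in[n]$, where $w_1,\dots,w_n$ are independent zero mean random vectors in $\mathbb R^d$ with $\mathbb E\,e^{\langle a,w_i\rangle}\le e^{\sigma^2\|a\|^2/2}$ for all $a\in\mathbb R^d$ ($\sigma>0$). Put $T_h^*=\{i\in[n]:z_i=h\}$, $n_h^*=|T_h^*|$, $\alpha=\min_g n_g^*/n$, $\Delta=\min_{g\ne h}\|\theta_g-\theta_h\|$, $\mathsf{SNR}=\Delta/(2\sigma)$. After seeing the data an adversary adds $n^{\mathsf{out}}=n\alpha(1-\delta)$ arbitrary points, $\delta\in(0,1]$. The algorithm produces labels $\hat z^{(s)}$ of all $n+n^{\mathsf{out}}$ points and centers $\hat\theta^{(s)}_1,\dots,\hat\theta^{(s)}_k$: for $s\ge 0$, $\hat z^{(s+1)}$ assigns every point to a nearest center $\hat\theta^{(s)}_h$ (ties broken arbitrarily), and for $s\ge1$, $\hat\theta_h^{(s)}$ is a coordinatewise median of the points labelled $h$ by $\hat z^{(s)}$.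 With $n_{gg}^{(0)}$ the number of $i\in T_g^*$ with $\hat z_i^{(0)}=g$, and $n_g^{(0)}$ the number of all points (added ones included) labelled $g$ by $\hat z^{(0)}$, let $$H_0=\min_{g}\min\Big\{\frac{n_{gg}^{(0)}}{n_g^*},\frac{n_{gg}^{(0)}}{n_g^{(0)}}\Big\},\qquad \Lambda_0=\max_h\frac{1}{\Delta}\|\hat\theta_h^{(0)}-\theta_h\| .$$ Let $F_{ij}$ be the distribution function of the $j$-th coordinate of $w_i$, and $F_{ij}^{-1}(u)=\inf\{x\in\mathbb R:F_{ij}(x)\ge u\}\in[-\infty,\infty]$ (so that it is $+\infty$ for $u>1$ and $-\infty$ for $u\le 0$). **Theorem.** There are absolute constants $c_1,c_2>0$ such that for every $\tau>0$ there is $C_\tau>0$, depending only on $\tau$, with the following property. Suppose that $n\alpha\ge 10\log n$, that $\sqrt\delta\cdot\mathsf{SNR}\sqrt{\alpha/d}\ge C_\tau$, and that the initialization satisfies one of $$H_0\ge\frac12+\frac{c_1}{\big(\mathsf{SNR}\sqrt{\alpha/d}\big)^2}\ \text{ (the initial centers being the coordinatewise medians for } \hat z^{(0)}),\qquad \Lambda_0\le\frac12-\frac{c_2}{\Big(\sqrt\delta\cdot\mathsf{SNR}\sqrt{\frac{\alpha}{1+dk/n}}\Big)^{1/2}}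 .$$ Then with probability at least $$1-8\max\{1,d\,n^{-4}\}\,n^{-1}-16\,d\,n^4e^{-0.3n}-2k^2\exp\{-\mathsf{SNR}/4\}$$ (where for $d\le n^4$ the second term is $8n^{-1}$) one has, simultaneously for all $h\in[k]$, all $s\ge2$, and all choices of the added points, of the admissible initialization and of the ties, $$\|\hat\theta_h^{(s)}-\theta_h\|^2\le d\Big[\max_{i\in T_h^*}\max_{j\in[d]}\max\Big\{\big|F_{ij}^{-1}(\tfrac12+p_\tau)\big|,\big|F_{ij}^{-1}(\tfrac12-p_\tau)\big|\Big\}\Big]^2,$$ $$p_\tau=\sqrt{\frac{3\log n}{n_h^*}}+e^{-\frac{1}{2+\tau/4}\mathsf{SNR}^2}+\frac{n^{\mathsf{out}}}{n^{\mathsf{out}}+n_h^*}.$$ -/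

import Mathlib

open MeasureTheory ProbabilityTheory
open scoped ENNReal

namespace RobustClustering

noncomputable section

/-- The errors `w₁, …, wₙ` are independent zero mean random vectors of `ℝᵈ` that are sub-Gaussian
with parameter `σ`: `E exp⟨a, wᵢ⟩ ≤ exp(σ²‖a‖²/2)` for all `i` and all `a`. -/
structure IsSubGaussianNoise {Ω : Type*} [MeasurableSpace Ω] (μ : Measure Ω) {n d : ℕ} (σ : ℝ)
    (w : Fin n → Ω → EuclideanSpace ℝ (Fin d)) : Prop where
  measurable : ∀ i, Measurable (w i)
  indep : iIndepFun w μ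
  zero_mean : ∀ i, ∫ ω, w i ω ∂μ = 0
  integrable_exp : ∀ i (a : EuclideanSpace ℝ (Fin d)),
    Integrable (fun ω => Real.exp (inner ℝ a (w i ω))) μ
  integral_exp_le : ∀ i (a : EuclideanSpace ℝ (Fin d)),
    ∫ ω, Real.exp (inner ℝ a (w i ω)) ∂μ ≤ Real.exp (σ ^ 2 * ‖a‖ ^ 2 / 2)

/-- The true cluster `T*_h` of a label vector `z`. -/
def trueCluster {n k : ℕ} (z : Fin n → Fin k) (h : Fin k) : Finset (Fin n) :=
  Finset.univ.filter fun i => z i = h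

/-- `n*_h = |T*_h|`. -/
def trueSize {n k : ℕ} (z : Fin n → Fin k) (h : Fin k) : ℕ := (trueCluster z h).card

/-- `α = min_g n*_g / n`. -/
def minFraction {n k : ℕ} (z : Fin n → Fin k) : ℝ := ⨅ g : Fin k, (trueSize z g : ℝ) / n

/-- `Δ = min_{g ≠ h} ‖θ_g - θ_h‖`. -/
def minSeparation {k d : ℕ} (θ : Fin k → EuclideanSpace ℝ (Fin d)) : ℝ :=
  ⨅ p : {p : Fin k × Fin k // p.1 ≠ p.2}, ‖θ p.1.1 - θ p.1.2‖

/-- `SNR = Δ / (2σ)`. -/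
def snr {k d : ℕ} (θ : Fin k → EuclideanSpace ℝ (Fin d)) (σ : ℝ) : ℝ := minSeparation θ / (2 * σ)

/-- The data set the algorithm sees: the `n` points `Y_i = θ_{z_i} + w_i` of the mixture model
(for one realisation `w` of the errors), together with the points `x` added by the adversary. -/
def dataset {n m k d : ℕ} (θ : Fin k → EuclideanSpace ℝ (Fin d)) (z : Fin n → Fin k)
    (w : Fin n → EuclideanSpace ℝ (Fin d)) (x : Fin m → EuclideanSpace ℝ (Fin d)) :
    Fin n ⊕ Fin m → EuclideanSpace ℝ (Fin d) :=
  Sum.elim (fun i => θ (z i) + w i) x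

/-- The set of all data points (added ones included) that carry the label `h`. -/
def labelled {ι : Type*} [Fintype ι] {k : ℕ} (lab : ι → Fin k) (h : Fin k) : Finset ι :=
  Finset.univ.filter fun i => lab i = h

/-- `c` is a median of the finite family `(v i)_{i ∈ S}`: at most half of the entries are smaller
and at most half of them are larger. Every convention for the middle of an even number of entries
is admitted. -/
def IsMedian {ι : Type*} (S : Finset ι) (v : ι → ℝ) (c : ℝ) : Prop :=
  2 * (S.filter fun i => v i < c).card ≤ S.card ∧ 2 * (S.filter fun i => c < v i).card ≤ S.card

/-- `c` is a coordinatewise median of the vectors `(P i)_{i ∈ S}`. -/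
def IsCoordMedian {ι : Type*} {d : ℕ} (S : Finset ι) (P : ι → EuclideanSpace ℝ (Fin d))
    (c : EuclideanSpace ℝ (Fin d)) : Prop :=
  ∀ j, IsMedian S (fun i => P i j) (c j)

/-- The sequences of labels and centers `(lab s, c s)`, `s = 0, 1, 2, …`, are produced by the
algorithm on the data set `P`: every point gets the label of a nearest current center (ties broken
arbitrarily), and every new center is a coordinatewise median of the points with its label.
The initialization `s = 0` is not restricted here. -/
structure IsRun {ι : Type*} [Fintype ι] {k d : ℕ} (P : ι → EuclideanSpace ℝ (Fin d))
    (lab : ℕ → ι → Fin k) (c : ℕ → Fin k → EuclideanSpace ℝ (Fin d)) : Prop where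
  assign : ∀ s i h, ‖P i - c s (lab (s + 1) i)‖ ^ 2 ≤ ‖P i - c s h‖ ^ 2
  update : ∀ s h, IsCoordMedian (labelled (lab (s + 1)) h) P (c (s + 1) h)

/-- The number of points of the true cluster `g` that are labelled `g`. -/
def correctSize {n m k : ℕ} (z : Fin n → Fin k) (lab : Fin n ⊕ Fin m → Fin k) (g : Fin k) : ℕ :=
  (Finset.univ.filter fun i : Fin n => z i = g ∧ lab (Sum.inl i) = g).card

/-- The cluster-wise correct labelling proportion
`H = min_g min {n_gg / n*_g, n_gg / n_g}`, where `n_g` counts the added points as well. -/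
def correctProportion {n m k : ℕ} (z : Fin n → Fin k) (lab : Fin n ⊕ Fin m → Fin k) : ℝ :=
  ⨅ g : Fin k, min ((correctSize z lab g : ℝ) / trueSize z g)
    ((correctSize z lab g : ℝ) / (labelled lab g).card)

/-- The error rate of the centers, `Λ = max_h ‖c_h - θ_h‖ / Δ`. -/
def centerError {k d : ℕ} (θ c : Fin k → EuclideanSpace ℝ (Fin d)) : ℝ :=
  ⨆ h : Fin k, 1 / minSeparation θ * ‖c h - θ h‖

/-- The condition on the initialization. Either the algorithm starts from labels `lab₀`, the centers
`c₀` being the coordinatewise medians for them, and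
`H₀ ≥ 1/2 + c₁ / (SNR √(α/d))²`; or the initial centers satisfy
`Λ₀ ≤ 1/2 - c₂ / (√δ SNR √(α/(1 + dk/n)))^{1/2}`. -/
def InitCondition {n m k d : ℕ} (c₁ c₂ δ σ : ℝ) (θ : Fin k → EuclideanSpace ℝ (Fin d))
    (z : Fin n → Fin k) (P : Fin n ⊕ Fin m → EuclideanSpace ℝ (Fin d))
    (lab₀ : Fin n ⊕ Fin m → Fin k) (c₀ : Fin k → EuclideanSpace ℝ (Fin d)) : Prop :=
  ((∀ h, IsCoordMedian (labelled lab₀ h) P (c₀ h)) ∧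
    1 / 2 + c₁ / (snr θ σ * √(minFraction z / d)) ^ 2 ≤ correctProportion z lab₀) ∨
  centerError θ c₀ ≤
    1 / 2 - c₂ / √(√δ * snr θ σ * √(minFraction z / (1 + (d : ℝ) * k / n)))

/-- The quantile function `F⁻¹(u) = inf {x | u ≤ F x}` of a law `ν` on the line, with values in
`[-∞, ∞]`: it is `∞` where no such `x` exists, and `-∞` for `u ≤ 0`. -/
def quantile (ν : Measure ℝ) (u : ℝ) : EReal := sInf (Real.toEReal '' {x : ℝ | u ≤ cdf ν x})

/-- `p_τ = √(3 log n / n*_h) + exp(-SNR² / (2 + τ/4)) + n^out / (n^out + n*_h)`. -/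
def pLevel {n k d : ℕ} (τ σ : ℝ) (m : ℕ) (θ : Fin k → EuclideanSpace ℝ (Fin d))
    (z : Fin n → Fin k) (h : Fin k) : ℝ :=
  √(3 * Real.log n / trueSize z h) + Real.exp (-(1 / (2 + τ / 4)) * snr θ σ ^ 2)
    + (m : ℝ) / ((m : ℝ) + trueSize z h)

/-- `max_{i ∈ T*_h} max_j max {|F_ij⁻¹(1/2 + p)|, |F_ij⁻¹(1/2 - p)|} ∈ [0, ∞]`, where `F_ij` is the
distribution function of the `j`-th coordinate of `w_i`. -/
def maxQuantile {Ω : Type*} [MeasurableSpace Ω] (μ : Measure Ω) {n k d : ℕ}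
    (w : Fin n → Ω → EuclideanSpace ℝ (Fin d)) (z : Fin n → Fin k) (h : Fin k) (p : ℝ) : ℝ≥0∞ :=
  ⨆ i ∈ trueCluster z h, ⨆ j : Fin d,
    max (quantile (μ.map fun ω => w i ω j) (1 / 2 + p)).abs
      (quantile (μ.map fun ω => w i ω j) (1 / 2 - p)).abs

end

end RobustClustering

open RobustClustering

/-! ### Exponential moments of squared norms. -/

namespace RobustClustering

/-! All randomness is put into one event about the noise alone (`exists_good_event`). On it the
argument is deterministic, hence uniform over added points, admissible initializations and ties. The
event asks, for every cluster: (1) the noise sums over all its subsets are short; (2) its total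
squared noise is at most `8σ²d` per point; (3) few pairs of a point and a wrong label are
"confusing", that is, the noise nearly crosses the bisector of the true centers or is longer than
`Δ`; (4) in each coordinate the numbers of noise values at most `Q` and at least `-Q`, `Q` being the
maximal quantile, are close to their expected lower bounds.

Coarse phase. If all centers are within `L` of the truth and `2(L + r) ≤ Δ`, each point moved from
`g` to `h` has noise component at least `r` along the one direction `c h - c g`. Adding these up and
using (1) bounds the number of moved points, so at most `δ/2` of a cluster's size is mislabelled. At
most a fraction `1 - δ` is added by the adversary, so on either side of a median there remain `δ/4`
of the true cluster, and (2) makes the new center accurate to `ε Δ`. This accuracy persists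
(`norm_sub_le_of_isRun`). Either initialization supplies a suitable first `L` and `r`
(`exists_radius_of_initCondition`).

Fine phase. With `ε Δ`-accurate centers only confusing pairs can be mislabelled, so by (3) fewer
than `n*_h exp(-η SNR²)` points are, with `η = 1/(2 + τ/4)`. By `card_trueCluster_filter_le`
mislabelled and added points shift the median rank by at most half their number. The three terms of
`pLevel` absorb the fluctuation in (4), the mislabelled points and the added points, so each
coordinate of the median error is at most `Q` in absolute value. -/

theorem lintegral_exp_mul_gaussianReal (t : ℝ) :
    ∫⁻ x, ENNReal.ofReal (Real.exp (t * x)) ∂(gaussianReal 0 1) =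
      ENNReal.ofReal (Real.exp (t ^ 2 / 2)) := by
  rw [← ofReal_integral_eq_lintegral_ofReal]
  · have := congrFun (mgf_fun_id_gaussianReal (μ := 0) (v := 1)) t
    simp only [mgf] at this
    rw [this]
    simp
  · exact integrable_exp_mul_gaussianReal t
  · exact Filter.Eventually.of_forall fun x => (Real.exp_pos _).le

/-- The exact value is `√2`; the bound `exp(1/2)` is the form whose `d`-fold product is `exp(d/2)`.
-/
theorem lintegral_exp_sq_div_four_gaussianReal_le :
    ∫⁻ x, ENNReal.ofReal (Real.exp (x ^ 2 / 4)) ∂(gaussianReal 0 1) ≤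
      ENNReal.ofReal (Real.exp (1 / 2)) := by
  rw [gaussianReal_of_var_ne_zero 0 one_ne_zero,
    lintegral_withDensity_eq_lintegral_mul _ (measurable_gaussianPDF 0 1) (by fun_prop)]
  have h1 : ∀ x : ℝ, (gaussianPDF 0 1 * fun x : ℝ => ENNReal.ofReal (Real.exp (x ^ 2 / 4))) x =
      ENNReal.ofReal ((√(2 * Real.pi))⁻¹ * Real.exp (-(1 / 4) * x ^ 2)) := by
    intro x
    simp only [Pi.mul_apply, gaussianPDF, gaussianPDFReal]
    rw [← ENNReal.ofReal_mul (by positivity), mul_assoc, ← Real.exp_add]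
    congr 3
    · simp
    · simp; ring
  simp_rw [h1]
  rw [← ofReal_integral_eq_lintegral_ofReal
    ((integrable_exp_neg_mul_sq (by norm_num)).const_mul _)
    (Filter.Eventually.of_forall fun x => by positivity)]
  apply ENNReal.ofReal_le_ofReal
  rw [integral_const_mul, integral_gaussian, ← Real.sqrt_inv, ← Real.sqrt_mul (by positivity)]
  have : (2 * Real.pi)⁻¹ * (Real.pi / (1 / 4)) = 2 := by
    field_simp; norm_num
  rw [this]
  have h2 : √2 ≤ 1 + 1 / 2 := by
    rw [Real.sqrt_le_left (by norm_num)]; norm_num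
  linarith [Real.add_one_le_exp (1 / 2 : ℝ)]

theorem lintegral_prod_pi_eq_prod {d : ℕ} (ν : Measure ℝ) [IsProbabilityMeasure ν]
    (f : Fin d → ℝ → ℝ≥0∞) (hf : ∀ j, Measurable (f j)) :
    ∫⁻ g, ∏ j, f j (g j) ∂(Measure.pi fun _ : Fin d => ν) = ∏ j, ∫⁻ x, f j x ∂ν := by
  have hi : iIndepFun (fun (j : Fin d) (g : Fin d → ℝ) => f j (g j))
      (Measure.pi fun _ : Fin d => ν) :=
    iIndepFun_pi (X := f) fun j => (hf j).aemeasurable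
  rw [lintegral_prod_eq_prod_lintegral_of_indepFun _ _ hi
    fun j => (hf j).comp (measurable_pi_apply j)]
  refine Finset.prod_congr rfl fun j _ => ?_
  exact (measurePreserving_eval (fun _ : Fin d => ν) j).lintegral_comp (hf j)

theorem ofReal_exp_sum {ι : Type*} (s : Finset ι) (f : ι → ℝ) :
    ENNReal.ofReal (Real.exp (∑ i ∈ s, f i)) = ∏ i ∈ s, ENNReal.ofReal (Real.exp (f i)) := by
  rw [Real.exp_sum, ENNReal.ofReal_prod_of_nonneg fun i _ => (Real.exp_pos _).le]

theorem prod_ofReal_exp_const {ι : Type*} (s : Finset ι) (a : ℝ) :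
    ∏ _i ∈ s, ENNReal.ofReal (Real.exp a) = ENNReal.ofReal (Real.exp (s.card * a)) := by
  rw [← ofReal_exp_sum, Finset.sum_const, nsmul_eq_mul]

/-- The exponential moment of the squared norm of a sub-Gaussian vector, obtained by averaging the
moment generating function over a Gaussian direction. -/
theorem lintegral_exp_norm_sq_le {Ω : Type*} [MeasurableSpace Ω] {μ : Measure Ω}
    [IsProbabilityMeasure μ] {d : ℕ} {s : ℝ} (hs : 0 < s) {X : Ω → EuclideanSpace ℝ (Fin d)}
    (hX : Measurable X)
    (hsub : ∀ a, ∫⁻ ω, ENNReal.ofReal (Real.exp (inner ℝ a (X ω))) ∂μ ≤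
      ENNReal.ofReal (Real.exp (s * ‖a‖ ^ 2 / 2))) :
    ∫⁻ ω, ENNReal.ofReal (Real.exp (‖X ω‖ ^ 2 / (4 * s))) ∂μ ≤
      ENNReal.ofReal (Real.exp (d / 2)) := by
  -- With `l² = 1/(2s)`, averaging `exp(l⟨g, x⟩)` over a standard Gaussian `g` gives exactly
  -- `exp(‖x‖²/(4s))`, while the sub-Gaussian bound at `a = l g` gives `exp(‖g‖²/4)`, which is still
  -- integrable.
  set l : ℝ := (√(2 * s))⁻¹ with hl
  have hl2 : l ^ 2 = 1 / (2 * s) := by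
    rw [hl, inv_pow, Real.sq_sqrt (by positivity), one_div]
  set γ : Measure (Fin d → ℝ) := Measure.pi fun _ => gaussianReal 0 1 with hγ
  have hinner : ∀ (g : Fin d → ℝ) (x : EuclideanSpace ℝ (Fin d)),
      inner ℝ (l • (WithLp.toLp 2 g : EuclideanSpace ℝ (Fin d))) x = ∑ j, l * x j * g j := by
    intro g x
    simp only [PiLp.inner_apply, PiLp.smul_apply, smul_eq_mul]
    refine Finset.sum_congr rfl fun j _ => ?_
    simp; ring
  have h1 : ∀ ω, ENNReal.ofReal (Real.exp (‖X ω‖ ^ 2 / (4 * s))) =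
      ∫⁻ g, ENNReal.ofReal (Real.exp (∑ j, l * X ω j * g j)) ∂γ := by
    intro ω
    simp_rw [ofReal_exp_sum]
    rw [lintegral_prod_pi_eq_prod _ (fun j x => ENNReal.ofReal (Real.exp (l * X ω j * x)))
      (by intro j; fun_prop)]
    simp_rw [lintegral_exp_mul_gaussianReal]
    rw [← ofReal_exp_sum, EuclideanSpace.norm_sq_eq, Finset.sum_div]
    congr 2
    refine Finset.sum_congr rfl fun j _ => ?_
    rw [mul_pow, hl2, Real.norm_eq_abs, sq_abs]
    field_simp; norm_num
  simp_rw [h1]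
  have hXj : ∀ j, Measurable fun ω => X ω j := fun j => by fun_prop
  rw [lintegral_lintegral_swap (by
    apply Measurable.aemeasurable
    refine ENNReal.measurable_ofReal.comp (Real.measurable_exp.comp ?_)
    refine Finset.measurable_sum _ fun j _ => ?_
    exact ((measurable_const.mul ((hXj j).comp measurable_fst))).mul
      ((measurable_pi_apply j).comp measurable_snd))]
  calc ∫⁻ g, ∫⁻ ω, ENNReal.ofReal (Real.exp (∑ j, l * X ω j * g j)) ∂μ ∂γ
      ≤ ∫⁻ g, ∏ j, ENNReal.ofReal (Real.exp ((g j) ^ 2 / 4)) ∂γ := by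
        refine lintegral_mono fun g => ?_
        simp_rw [← hinner]
        refine (hsub _).trans_eq ?_
        rw [← ofReal_exp_sum, norm_smul, mul_pow, Real.norm_eq_abs, sq_abs, hl2,
          EuclideanSpace.norm_sq_eq, ← Finset.sum_div]
        congr 2
        simp only [Real.norm_eq_abs, sq_abs]
        field_simp
        norm_num
        ring
    _ = ∏ j : Fin d, ∫⁻ x, ENNReal.ofReal (Real.exp (x ^ 2 / 4)) ∂(gaussianReal 0 1) :=
        lintegral_prod_pi_eq_prod _ (fun _ x => ENNReal.ofReal (Real.exp (x ^ 2 / 4)))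
          (by intro j; fun_prop)
    _ ≤ ∏ j : Fin d, ENNReal.ofReal (Real.exp (1 / 2)) :=
        Finset.prod_le_prod' fun j _ => lintegral_exp_sq_div_four_gaussianReal_le
    _ = ENNReal.ofReal (Real.exp (d / 2)) := by
        rw [prod_ofReal_exp_const]; simp [div_eq_mul_inv]

/-- Exponential Markov inequality. -/
theorem measure_ge_le_exp {Ω : Type*} [MeasurableSpace Ω] {μ : Measure Ω} {f : Ω → ℝ}
    (hf : Measurable f) {a t : ℝ}
    (h : ∫⁻ ω, ENNReal.ofReal (Real.exp (f ω)) ∂μ ≤ ENNReal.ofReal (Real.exp a)) :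
    μ {ω | t ≤ f ω} ≤ ENNReal.ofReal (Real.exp (a - t)) := by
  have h1 := meas_ge_le_lintegral_div (μ := μ)
    (f := fun ω => ENNReal.ofReal (Real.exp (f ω))) (by fun_prop)
    (ε := ENNReal.ofReal (Real.exp t)) (by simp [Real.exp_pos]) (by simp)
  have h2 : {ω | t ≤ f ω} = {ω | ENNReal.ofReal (Real.exp t) ≤ ENNReal.ofReal (Real.exp (f ω))} := by
    ext ω
    simp [ENNReal.ofReal_le_ofReal_iff (Real.exp_pos _).le]
  rw [h2]
  refine h1.trans ((ENNReal.div_le_div_right h _).trans_eq ?_)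
  rw [Real.exp_sub, ENNReal.ofReal_div_of_pos (Real.exp_pos _)]

/-! ### Tail bounds for the noise. -/

section Noise

variable {Ω : Type*} [MeasurableSpace Ω] {μ : Measure Ω} {n d : ℕ} {σ : ℝ}
  {w : Fin n → Ω → EuclideanSpace ℝ (Fin d)}

theorem IsSubGaussianNoise.lintegral_exp_inner_sum_le (hw : IsSubGaussianNoise μ σ w)
    (S : Finset (Fin n)) (a : EuclideanSpace ℝ (Fin d)) :
    ∫⁻ ω, ENNReal.ofReal (Real.exp (inner ℝ a (∑ i ∈ S, w i ω))) ∂μ ≤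
      ENNReal.ofReal (Real.exp (S.card * σ ^ 2 * ‖a‖ ^ 2 / 2)) := by
  simp_rw [inner_sum, ofReal_exp_sum]
  have hm : ∀ i, Measurable (w i) := hw.measurable
  have hi : iIndepFun (fun i ω => ENNReal.ofReal (Real.exp (inner ℝ a (w i ω)))) μ :=
    hw.indep.comp (fun _ x => ENNReal.ofReal (Real.exp (inner ℝ a x))) fun _ => by fun_prop
  rw [lintegral_prod_eq_prod_lintegral_of_indepFun _ _ hi fun i => by fun_prop]
  calc ∏ i ∈ S, ∫⁻ ω, ENNReal.ofReal (Real.exp (inner ℝ a (w i ω))) ∂μ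
      ≤ ∏ i ∈ S, ENNReal.ofReal (Real.exp (σ ^ 2 * ‖a‖ ^ 2 / 2)) := by
        refine Finset.prod_le_prod' fun i _ => ?_
        rw [← ofReal_integral_eq_lintegral_ofReal (hw.integrable_exp i a)
          (Filter.Eventually.of_forall fun _ => (Real.exp_pos _).le)]
        exact ENNReal.ofReal_le_ofReal (hw.integral_exp_le i a)
    _ = _ := by rw [prod_ofReal_exp_const]; congr 2; ring

theorem IsSubGaussianNoise.lintegral_exp_inner_le (hw : IsSubGaussianNoise μ σ w)
    (i : Fin n) (a : EuclideanSpace ℝ (Fin d)) :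
    ∫⁻ ω, ENNReal.ofReal (Real.exp (inner ℝ a (w i ω))) ∂μ ≤
      ENNReal.ofReal (Real.exp (σ ^ 2 * ‖a‖ ^ 2 / 2)) := by
  simpa using hw.lintegral_exp_inner_sum_le {i} a

theorem IsSubGaussianNoise.measure_inner_ge_le (hw : IsSubGaussianNoise μ σ w) (hσ : 0 < σ)
    (i : Fin n) (a : EuclideanSpace ℝ (Fin d)) {r : ℝ} (hr : 0 < r) :
    μ {ω | r * ‖a‖ ^ 2 ≤ inner ℝ a (w i ω)} ≤
      ENNReal.ofReal (Real.exp (-(r ^ 2 * ‖a‖ ^ 2 / (2 * σ ^ 2)))) := by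
  have hm := hw.measurable i
  -- The factor `r/σ²` is the optimal Chernoff tilt.
  have h := measure_ge_le_exp (f := fun ω => inner ℝ ((r / σ ^ 2) • a) (w i ω)) (by fun_prop)
    (t := r ^ 2 * ‖a‖ ^ 2 / σ ^ 2) (hw.lintegral_exp_inner_le i ((r / σ ^ 2) • a))
  refine (measure_mono fun ω hω => ?_).trans (h.trans_eq ?_)
  · simp only [Set.mem_ofPred_eq, inner_smul_left] at hω ⊢
    have := mul_le_mul_of_nonneg_left hω (show 0 ≤ r / σ ^ 2 by positivity)
    simp only [conj_trivial]
    refine le_trans (le_of_eq ?_) this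
    ring
  · congr 2
    rw [norm_smul, mul_pow, Real.norm_eq_abs, sq_abs]
    field_simp
    ring

variable [IsProbabilityMeasure μ]

theorem measure_norm_sq_ge_le {s : ℝ} (hs : 0 < s) {X : Ω → EuclideanSpace ℝ (Fin d)}
    (hX : Measurable X)
    (hsub : ∀ a, ∫⁻ ω, ENNReal.ofReal (Real.exp (inner ℝ a (X ω))) ∂μ ≤
      ENNReal.ofReal (Real.exp (s * ‖a‖ ^ 2 / 2))) (t : ℝ) :
    μ {ω | 4 * s * t ≤ ‖X ω‖ ^ 2} ≤ ENNReal.ofReal (Real.exp (d / 2 - t)) := by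
  have h := measure_ge_le_exp (f := fun ω => ‖X ω‖ ^ 2 / (4 * s)) (by fun_prop) (t := t)
    (lintegral_exp_norm_sq_le hs hX hsub)
  refine (measure_mono fun ω hω => ?_).trans h
  simp only [Set.mem_ofPred_eq] at hω ⊢
  rw [le_div_iff₀ (by positivity)]
  linarith

theorem two_pow_le_exp (m : ℕ) : (2 : ℝ) ^ m ≤ Real.exp m := by
  rw [← Real.exp_one_pow]
  exact pow_le_pow_left₀ (by norm_num) (by linarith [Real.add_one_le_exp (1 : ℝ)]) m

/-- Simultaneously for all subsets of a cluster, the partial sums of the noise are not too long. -/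
theorem IsSubGaussianNoise.measure_exists_norm_sum_sq_ge_le (hw : IsSubGaussianNoise μ σ w)
    (hσ : 0 < σ) (T : Finset (Fin n)) :
    μ {ω | ∃ S ⊆ T, 8 * σ ^ 2 * S.card * (T.card + d) < ‖∑ i ∈ S, w i ω‖ ^ 2} ≤
      ENNReal.ofReal (Real.exp (-T.card)) := by
  have hsub : {ω | ∃ S ⊆ T, 8 * σ ^ 2 * S.card * (T.card + d) < ‖∑ i ∈ S, w i ω‖ ^ 2} ⊆
      ⋃ S ∈ T.powerset, {ω | 8 * σ ^ 2 * S.card * (T.card + d) < ‖∑ i ∈ S, w i ω‖ ^ 2} := by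
    rintro ω ⟨S, hS, h⟩
    simp only [Set.mem_iUnion, Finset.mem_powerset]
    exact ⟨S, hS, h⟩
  have hone : ∀ S ∈ T.powerset,
      μ {ω | 8 * σ ^ 2 * S.card * (T.card + d) < ‖∑ i ∈ S, w i ω‖ ^ 2} ≤
        ENNReal.ofReal (Real.exp (-(2 * T.card))) := by
    intro S _
    -- For the empty set the strict inequality reads `0 < 0`, so nothing is lost.
    rcases S.eq_empty_or_nonempty with rfl | hS
    · simp
    have hc : (0 : ℝ) < S.card := by exact_mod_cast hS.card_pos
    have hm : ∀ i, Measurable (w i) := hw.measurable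
    -- The level `2(|T| + d)` leaves `exp(-2|T|)` for each subset; one factor `exp(-|T|)` pays for
    -- the union over `2^|T|` subsets.
    have h := measure_norm_sq_ge_le (μ := μ) (X := fun ω => ∑ i ∈ S, w i ω)
      (s := S.card * σ ^ 2) (by positivity) (by fun_prop)
      (hw.lintegral_exp_inner_sum_le S) (2 * (T.card + d))
    refine (measure_mono fun ω hω => ?_).trans (h.trans ?_)
    · simp only [Set.mem_ofPred_eq] at hω ⊢
      linarith
    · apply ENNReal.ofReal_le_ofReal
      apply Real.exp_le_exp.2
      have : (0 : ℝ) ≤ d := by positivity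
      linarith
  calc _ ≤ _ := measure_mono hsub
    _ ≤ ∑ S ∈ T.powerset, μ {ω | 8 * σ ^ 2 * S.card * (T.card + d) < ‖∑ i ∈ S, w i ω‖ ^ 2} :=
        measure_biUnion_finset_le _ _
    _ ≤ ∑ S ∈ T.powerset, ENNReal.ofReal (Real.exp (-(2 * T.card))) := Finset.sum_le_sum hone
    _ = ENNReal.ofReal (2 ^ T.card * Real.exp (-(2 * T.card))) := by
        rw [Finset.sum_const, Finset.card_powerset, nsmul_eq_mul, ENNReal.ofReal_mul (by positivity)]
        congr 1
        rw [ENNReal.ofReal_pow (by norm_num)]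
        simp
    _ ≤ _ := by
        apply ENNReal.ofReal_le_ofReal
        refine (mul_le_mul_of_nonneg_right (two_pow_le_exp _) (Real.exp_pos _).le).trans_eq ?_
        rw [← Real.exp_add]; congr 1; ring

theorem IsSubGaussianNoise.measure_sum_norm_sq_ge_le (hw : IsSubGaussianNoise μ σ w)
    (hσ : 0 < σ) (hd : 1 ≤ d) (T : Finset (Fin n)) :
    μ {ω | 8 * σ ^ 2 * d * T.card ≤ ∑ i ∈ T, ‖w i ω‖ ^ 2} ≤
      ENNReal.ofReal (Real.exp (-T.card)) := by
  have hm : ∀ i, Measurable (w i) := hw.measurable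
  have hi : iIndepFun (fun i ω => ENNReal.ofReal (Real.exp (‖w i ω‖ ^ 2 / (4 * σ ^ 2)))) μ :=
    hw.indep.comp (fun _ x => ENNReal.ofReal (Real.exp (‖x‖ ^ 2 / (4 * σ ^ 2)))) fun _ => by fun_prop
  have h1 : ∫⁻ ω, ENNReal.ofReal (Real.exp (∑ i ∈ T, ‖w i ω‖ ^ 2 / (4 * σ ^ 2))) ∂μ ≤
      ENNReal.ofReal (Real.exp (T.card * (d / 2))) := by
    simp_rw [ofReal_exp_sum]
    rw [lintegral_prod_eq_prod_lintegral_of_indepFun _ _ hi fun i => by fun_prop,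
      ← prod_ofReal_exp_const]
    exact Finset.prod_le_prod' fun i _ =>
      lintegral_exp_norm_sq_le (by positivity) (hm i) (hw.lintegral_exp_inner_le i)
  have h := measure_ge_le_exp (t := 2 * d * T.card) (by fun_prop) h1
  refine (measure_mono fun ω hω => ?_).trans (h.trans ?_)
  · simp only [Set.mem_ofPred_eq] at hω ⊢
    rw [← Finset.sum_div, le_div_iff₀ (by positivity)]
    linarith
  · apply ENNReal.ofReal_le_ofReal
    apply Real.exp_le_exp.2
    have : (1 : ℝ) ≤ d := by exact_mod_cast hd
    have h2 := mul_le_mul_of_nonneg_right this (show (0 : ℝ) ≤ T.card by positivity)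
    nlinarith

/-- Hoeffding's inequality for the number of noise vectors in a set. -/
theorem IsSubGaussianNoise.measure_card_le_le (hw : IsSubGaussianNoise μ σ w)
    {A : Set (EuclideanSpace ℝ (Fin d))} [DecidablePred (· ∈ A)] (hA : MeasurableSet A)
    (T : Finset (Fin n)) {q s : ℝ} (hs : 0 ≤ s) (hq : ∀ i ∈ T, q ≤ μ.real (w i ⁻¹' A)) :
    μ {ω | ((T.filter fun i => w i ω ∈ A).card : ℝ) ≤ q * T.card - s} ≤
      ENNReal.ofReal (Real.exp (-(2 * s ^ 2 / T.card))) := by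
  have hm : ∀ i, Measurable (w i) := hw.measurable
  set Y : Fin n → Ω → ℝ := fun i ω => A.indicator (fun _ => (1 : ℝ)) (w i ω) with hY
  have hYm : ∀ i, Measurable (Y i) := fun i => (measurable_const.indicator hA).comp (hm i)
  have hYint : ∀ i, ∫ ω, Y i ω ∂μ = μ.real (w i ⁻¹' A) := by
    intro i
    have : Y i = (w i ⁻¹' A).indicator 1 := by
      ext ω; simp [hY, Set.indicator]
    rw [this, integral_indicator_one (hm i hA)]
  -- The sign turns the lower tail of the count into an upper tail.
  set X : Fin n → Ω → ℝ := fun i ω => -(Y i ω - ∫ ω, Y i ω ∂μ) with hX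
  have hXi : iIndepFun X μ :=
    hw.indep.comp (fun i x => -(A.indicator (fun _ => (1 : ℝ)) x - ∫ ω, Y i ω ∂μ)) fun i =>
      ((measurable_const.indicator hA).sub_const _).neg
  have hXs : ∀ i ∈ T, HasSubgaussianMGF (X i) ((‖(1 : ℝ) - 0‖₊ / 2) ^ 2) μ := by
    intro i _
    refine (hasSubgaussianMGF_of_mem_Icc (hYm i).aemeasurable
      (Filter.Eventually.of_forall fun ω => ?_)).neg
    simp only [hY, Set.indicator]
    split_ifs <;> simp
  have h := HasSubgaussianMGF.measure_sum_ge_le_of_iIndepFun hXi hXs hs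
  rw [← ENNReal.ofReal_le_ofReal_iff (Real.exp_pos _).le, measureReal_def,
    ENNReal.ofReal_toReal (measure_ne_top _ _)] at h
  refine (measure_mono fun ω hω => ?_).trans (h.trans_eq ?_)
  · simp only [Set.mem_ofPred_eq] at hω ⊢
    have hc : ∑ i ∈ T, Y i ω = ((T.filter fun i => w i ω ∈ A).card : ℝ) := by
      simp only [hY, Set.indicator, Finset.sum_ite, Finset.sum_const]
      simp
    have h2 : q * T.card ≤ ∑ i ∈ T, ∫ ω, Y i ω ∂μ := by
      rw [mul_comm, ← nsmul_eq_mul]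
      exact Finset.card_nsmul_le_sum _ _ _ fun i hi => (hq i hi).trans_eq (hYint i).symm
    simp only [hX, Finset.sum_neg_distrib, Finset.sum_sub_distrib, hc]
    linarith
  · congr 2
    simp
    rcases T.eq_empty_or_nonempty with rfl | hT
    · simp
    have hc : (T.card : ℝ) ≠ 0 := by simpa using hT.ne_empty
    field_simp

end Noise

/-- Markov's inequality for a counting variable. It needs no independence, which suits pairs sharing
the same noise vector. -/
theorem measure_card_ge_le {Ω ι : Type*} [MeasurableSpace Ω] (μ : Measure Ω) (A : Finset ι)
    (B : ι → Set Ω) [∀ a ω, Decidable (ω ∈ B a)] (hB : ∀ a ∈ A, MeasurableSet (B a)) {p t : ℝ}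
    (ht : 0 < t) (hp : ∀ a ∈ A, μ (B a) ≤ ENNReal.ofReal p) :
    μ {ω | t ≤ ((A.filter fun a => ω ∈ B a).card : ℝ)} ≤ ENNReal.ofReal (A.card * p / t) := by
  set f : Ω → ℝ≥0∞ := fun ω => ∑ a ∈ A, (B a).indicator 1 ω with hf
  have hfm : Measurable f := Finset.measurable_sum _ fun a ha => measurable_one.indicator (hB a ha)
  have h := meas_ge_le_lintegral_div (μ := μ) hfm.aemeasurable (ε := ENNReal.ofReal t)
    (by simpa using ht) (by simp)
  refine (measure_mono fun ω hω => ?_).trans (h.trans ?_)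
  · simp only [Set.mem_ofPred_eq] at hω ⊢
    have : f ω = ENNReal.ofReal ((A.filter fun a => ω ∈ B a).card : ℝ) := by
      simp [hf, Set.indicator]
    rw [this]
    exact ENNReal.ofReal_le_ofReal hω
  · rw [ENNReal.ofReal_div_of_pos ht]
    gcongr
    rw [hf, lintegral_finsetSum' _ fun a ha => (measurable_one.indicator (hB a ha)).aemeasurable]
    rw [ENNReal.ofReal_mul (by positivity), ENNReal.ofReal_natCast, ← nsmul_eq_mul]
    refine Finset.sum_le_card_nsmul _ _ _ fun a ha => ?_
    rw [lintegral_indicator_one (hB a ha)]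
    exact hp a ha

/-! ### Counting labels, and medians under contamination. -/

section Counting

variable {n m k d : ℕ}

/-- The points of the mixture that the labels `lab` put wrongly into or out of the cluster `h`. -/
def mislabelled (z : Fin n → Fin k) (lab : Fin n ⊕ Fin m → Fin k) (h : Fin k) : Finset (Fin n) :=
  Finset.univ.filter fun i => ¬(z i = h ↔ lab (Sum.inl i) = h)

theorem card_labelled (lab : Fin n ⊕ Fin m → Fin k) (h : Fin k) :
    (labelled lab h).card = (Finset.univ.filter fun i : Fin n => lab (Sum.inl i) = h).card +
      (Finset.univ.filter fun i : Fin m => lab (Sum.inr i) = h).card := by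
  simp only [labelled, Finset.card_filter, Fintype.sum_sum_type]

theorem card_labelled_filter_inl_le (lab : Fin n ⊕ Fin m → Fin k) (h : Fin k)
    (P : Fin n ⊕ Fin m → Prop) [DecidablePred P] :
    (Finset.univ.filter fun i : Fin n => lab (Sum.inl i) = h ∧ P (Sum.inl i)).card ≤
      ((labelled lab h).filter P).card := by
  simp only [labelled, Finset.filter_filter, Finset.card_filter, Fintype.sum_sum_type]
  exact Nat.le_add_right _ _

/-- `|A| + |B| = 2|A ∩ B| + |A △ B|`. -/
theorem card_add_trueSize_eq (z : Fin n → Fin k) (lab : Fin n ⊕ Fin m → Fin k)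
    (h : Fin k) :
    (Finset.univ.filter fun i : Fin n => lab (Sum.inl i) = h).card + trueSize z h =
      2 * correctSize z lab h + (mislabelled z lab h).card := by
  simp only [trueSize, trueCluster, correctSize, mislabelled, Finset.card_filter,
    ← Finset.sum_add_distrib, Finset.mul_sum]
  refine Finset.sum_congr rfl fun i _ => ?_
  by_cases h1 : z i = h <;> by_cases h2 : lab (Sum.inl i) = h <;> simp [h1, h2]

/-- Transfers "at most half" from the labelled set to the true cluster. Cluster points with `P` are
either labelled `h` or among the cluster points missed by the labels; doubling and using
`card_add_trueSize_eq` makes each mislabelled point, like each added point, count only once. -/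
theorem card_trueCluster_filter_le (z : Fin n → Fin k) (lab : Fin n ⊕ Fin m → Fin k) (h : Fin k)
    (P : Fin n ⊕ Fin m → Prop) [DecidablePred P]
    (hP : 2 * ((labelled lab h).filter P).card ≤ (labelled lab h).card) :
    2 * ((trueCluster z h).filter fun i => P (Sum.inl i)).card ≤
      trueSize z h + (mislabelled z lab h).card + m := by
  have h1 := card_labelled lab h
  have h2 := card_labelled_filter_inl_le lab h P
  have h3 := card_add_trueSize_eq z lab h
  have h4 : (Finset.univ.filter fun i : Fin m => lab (Sum.inr i) = h).card ≤ m := by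
    simpa using Finset.card_le_univ (Finset.univ.filter fun i : Fin m => lab (Sum.inr i) = h)
  have h5 : ((trueCluster z h).filter fun i => P (Sum.inl i)).card + correctSize z lab h ≤
      (Finset.univ.filter fun i : Fin n => lab (Sum.inl i) = h ∧ P (Sum.inl i)).card +
        trueSize z h := by
    simp only [trueSize, trueCluster, correctSize, Finset.filter_filter, Finset.card_filter,
      ← Finset.sum_add_distrib]
    refine Finset.sum_le_sum fun i _ => ?_
    by_cases h1 : z i = h <;> by_cases h2 : lab (Sum.inl i) = h <;>
      by_cases h3 : P (Sum.inl i) <;> simp [h1, h2, h3]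
  omega

/-- The counterpart used for an initialization by labels, where only the correctly labelled points
are controlled. -/
theorem correctSize_le_card_labelled_add (z : Fin n → Fin k) (lab : Fin n ⊕ Fin m → Fin k)
    (h : Fin k) (P : Fin n ⊕ Fin m → Prop) [DecidablePred P]
    (hP : 2 * ((labelled lab h).filter P).card ≤ (labelled lab h).card) :
    2 * correctSize z lab h ≤ (labelled lab h).card +
      2 * ((trueCluster z h).filter fun i => ¬P (Sum.inl i)).card := by
  have h2 := card_labelled_filter_inl_le lab h P
  have h5 : correctSize z lab h ≤
      (Finset.univ.filter fun i : Fin n => lab (Sum.inl i) = h ∧ P (Sum.inl i)).card +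
        ((trueCluster z h).filter fun i => ¬P (Sum.inl i)).card := by
    simp only [trueCluster, correctSize, Finset.filter_filter, Finset.card_filter,
      ← Finset.sum_add_distrib]
    refine Finset.sum_le_sum fun i _ => ?_
    by_cases h1 : z i = h <;> by_cases h2 : lab (Sum.inl i) = h <;>
      by_cases h3 : P (Sum.inl i) <;> simp [h1, h2, h3]
  omega

/-- The witnessing subset may change with the coordinate, since the squared norms are summed
coordinate by coordinate. -/
theorem mul_norm_sq_le_sum_norm_sq {ι : Type*} (T : Finset ι) (v : ι → EuclideanSpace ℝ (Fin d))
    (u : EuclideanSpace ℝ (Fin d)) {N : ℝ}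
    (h : ∀ j, ∃ S ⊆ T, N ≤ S.card ∧ ∀ i ∈ S, (u j) ^ 2 ≤ (v i j) ^ 2) :
    N * ‖u‖ ^ 2 ≤ ∑ i ∈ T, ‖v i‖ ^ 2 := by
  simp only [EuclideanSpace.norm_sq_eq, Real.norm_eq_abs, sq_abs]
  rw [Finset.sum_comm, Finset.mul_sum]
  refine Finset.sum_le_sum fun j _ => ?_
  obtain ⟨S, hST, hN, hS⟩ := h j
  calc N * (u j) ^ 2 ≤ S.card * (u j) ^ 2 := by gcongr
    _ = S.card • (u j) ^ 2 := by rw [nsmul_eq_mul]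
    _ ≤ ∑ i ∈ S, (v i j) ^ 2 := Finset.card_nsmul_le_sum _ _ _ hS
    _ ≤ ∑ i ∈ T, (v i j) ^ 2 := Finset.sum_le_sum_of_subset_of_nonneg hST fun _ _ _ => sq_nonneg _

/-- If at least `N` points of the true cluster lie outside of every set of at most half of the
points labelled `h`, then a coordinatewise median of the points labelled `h` is controlled by the
second moment of the noise in the cluster. -/
theorem mul_norm_sub_sq_le_of_isCoordMedian (θ : Fin k → EuclideanSpace ℝ (Fin d))
    (z : Fin n → Fin k) (w : Fin n → EuclideanSpace ℝ (Fin d))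
    (x : Fin m → EuclideanSpace ℝ (Fin d)) (lab : Fin n ⊕ Fin m → Fin k) (h : Fin k)
    (c : EuclideanSpace ℝ (Fin d)) (hc : IsCoordMedian (labelled lab h) (dataset θ z w x) c) {N : ℝ}
    (hN : ∀ (P : Fin n ⊕ Fin m → Prop) [DecidablePred P],
      2 * ((labelled lab h).filter P).card ≤ (labelled lab h).card →
        N ≤ ((trueCluster z h).filter fun i => ¬P (Sum.inl i)).card) :
    N * ‖c - θ h‖ ^ 2 ≤ ∑ i ∈ trueCluster z h, ‖w i‖ ^ 2 := by
  refine mul_norm_sq_le_sum_norm_sq _ w _ fun j => ?_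
  -- On the side to which the median errs, every cluster point not before the median has noise at
  -- least as large as the error.
  rcases le_total 0 ((c - θ h) j) with hu | hu
  · refine ⟨_, Finset.filter_subset _ _, hN _ (hc j).1, fun i hi => ?_⟩
    simp only [trueCluster, Finset.mem_filter, Finset.mem_univ, true_and] at hi
    obtain ⟨rfl, hi⟩ := hi
    simp only [dataset, Sum.elim_inl, PiLp.add_apply, not_lt] at hi
    simp only [PiLp.sub_apply] at hu ⊢
    nlinarith
  · refine ⟨_, Finset.filter_subset _ _, hN _ (hc j).2, fun i hi => ?_⟩
    simp only [trueCluster, Finset.mem_filter, Finset.mem_univ, true_and] at hi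
    obtain ⟨rfl, hi⟩ := hi
    simp only [dataset, Sum.elim_inl, PiLp.add_apply, not_lt] at hi
    simp only [PiLp.sub_apply] at hu ⊢
    nlinarith

/-- With `N = n*_h`, the number left beyond the median is at least `N - (N + δN/2 + (1 - δ)N)/2 =
δN/4`. -/
theorem mul_norm_sub_sq_le_of_mislabelled (θ : Fin k → EuclideanSpace ℝ (Fin d))
    (z : Fin n → Fin k) (w : Fin n → EuclideanSpace ℝ (Fin d))
    (x : Fin m → EuclideanSpace ℝ (Fin d)) (lab : Fin n ⊕ Fin m → Fin k) (h : Fin k)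
    (c : EuclideanSpace ℝ (Fin d)) (hc : IsCoordMedian (labelled lab h) (dataset θ z w x) c) {δ : ℝ}
    (hm : (m : ℝ) ≤ (1 - δ) * trueSize z h)
    (hW : ((mislabelled z lab h).card : ℝ) ≤ δ / 2 * trueSize z h) :
    δ / 4 * trueSize z h * ‖c - θ h‖ ^ 2 ≤ ∑ i ∈ trueCluster z h, ‖w i‖ ^ 2 := by
  refine mul_norm_sub_sq_le_of_isCoordMedian θ z w x lab h c hc fun P _ hP => ?_
  have h1 := card_trueCluster_filter_le z lab h P hP
  have h2 := Finset.card_filter_add_card_filter_not (s := trueCluster z h)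
    (fun i => P (Sum.inl i))
  rw [← trueSize] at h2
  have h1' : 2 * (((trueCluster z h).filter fun i => P (Sum.inl i)).card : ℝ) ≤
      trueSize z h + (mislabelled z lab h).card + m := by exact_mod_cast h1
  have h2' : (((trueCluster z h).filter fun i => P (Sum.inl i)).card : ℝ) +
    ((trueCluster z h).filter fun i => ¬P (Sum.inl i)).card = trueSize z h := by exact_mod_cast h2
  linarith

theorem mul_norm_sub_sq_le_of_correctProportion (θ : Fin k → EuclideanSpace ℝ (Fin d))
    (z : Fin n → Fin k) (w : Fin n → EuclideanSpace ℝ (Fin d))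
    (x : Fin m → EuclideanSpace ℝ (Fin d)) (lab : Fin n ⊕ Fin m → Fin k) (h : Fin k)
    (c : EuclideanSpace ℝ (Fin d)) (hc : IsCoordMedian (labelled lab h) (dataset θ z w x) c) {γ : ℝ}
    (hγ : 0 < γ) (hT : 0 < trueSize z h) (hH : 1 / 2 + γ ≤ correctProportion z lab) :
    γ * trueSize z h * ‖c - θ h‖ ^ 2 ≤ ∑ i ∈ trueCluster z h, ‖w i‖ ^ 2 := by
  have hH' := hH.trans (ciInf_le (Set.finite_range _).bddBelow h)
  have hT' : (0 : ℝ) < trueSize z h := by exact_mod_cast hT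
  have hA := hH'.trans (min_le_left _ _)
  have hB := hH'.trans (min_le_right _ _)
  rw [le_div_iff₀ hT'] at hA
  -- An empty label class would make the quotient `0` by convention, contradicting the lower bound.
  have hL : (0 : ℝ) < (labelled lab h).card := by
    rcases (Nat.cast_nonneg (α := ℝ) (labelled lab h).card).eq_or_lt with h0 | h0
    · rw [← h0, div_zero] at hB; linarith
    · exact h0
  rw [le_div_iff₀ hL] at hB
  refine mul_norm_sub_sq_le_of_isCoordMedian θ z w x lab h c hc fun P _ hP => ?_
  have h1 := correctSize_le_card_labelled_add z lab h P hP
  have h1' : 2 * (correctSize z lab h : ℝ) ≤ (labelled lab h).card +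
      2 * ((trueCluster z h).filter fun i => ¬P (Sum.inl i)).card := by exact_mod_cast h1
  -- The correct count is at least `1/2 + γ` times the larger of the two sizes; removing half of the
  -- labelled set leaves at least `γ n*_h`.
  rcases le_total (trueSize z h : ℝ) (labelled lab h).card with h4 | h4
  · nlinarith [mul_le_mul_of_nonneg_left h4 hγ.le]
  · nlinarith

end Counting

/-! ### Geometry of a wrong assignment. -/

section Geometry

variable {E : Type*} [NormedAddCommGroup E] [InnerProductSpace ℝ E]

theorem norm_sq_le_inner_of_nearer {θ w a b : E} (h : ‖θ + w - b‖ ^ 2 ≤ ‖θ + w - a‖ ^ 2) :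
    ‖b - a‖ ^ 2 / 2 + inner ℝ (a - θ) (b - a) ≤ inner ℝ w (b - a) := by
  have h1 : θ + w - b = (w - (a - θ)) - (b - a) := by abel
  have h2 : θ + w - a = w - (a - θ) := by abel
  rw [h1, h2, norm_sub_sq_real (w - (a - θ)) (b - a), inner_sub_left] at h
  linarith

/-- The true center keeps distance `r` from the bisector of `a` and `b`. If `‖b - a‖ ≥ 2(L + r)`,
Cauchy–Schwarz suffices. Otherwise `‖b - θ‖ ≥ 2r + L` yields `‖b - a‖² + 2⟨a - θ, b - a⟩ ≥ (2r + L)²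
- L² = 4r(r + L)`, which is at least `2r‖b - a‖`. This is what permits `L` close to `Δ/2`. -/
theorem mul_norm_le_inner_of_nearer {θ θ' w a b : E} {L r : ℝ} (hL : ‖a - θ‖ ≤ L)
    (hL' : ‖b - θ'‖ ≤ L) (hr : 0 < r) (hsep : 2 * (L + r) ≤ ‖θ' - θ‖)
    (h : ‖θ + w - b‖ ^ 2 ≤ ‖θ + w - a‖ ^ 2) :
    0 < ‖b - a‖ ∧ r * ‖b - a‖ ≤ inner ℝ w (b - a) := by
  have h1 := norm_sq_le_inner_of_nearer h
  have hL0 := (norm_nonneg _).trans hL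
  have h2 : 2 * r + L ≤ ‖(b - a) + (a - θ)‖ := by
    have : θ' - θ = ((b - a) + (a - θ)) - (b - θ') := by abel
    rw [this] at hsep
    linarith [norm_sub_le ((b - a) + (a - θ)) (b - θ')]
  have h3 : 2 * r ≤ ‖b - a‖ := by linarith [norm_add_le (b - a) (a - θ)]
  refine ⟨by linarith, le_trans ?_ h1⟩
  have h4 := abs_le.1 (abs_real_inner_le_norm (a - θ) (b - a))
  rcases le_total (2 * (r + L)) ‖b - a‖ with h5 | h5
  · nlinarith [mul_le_mul_of_nonneg_right hL (norm_nonneg (b - a)),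
      mul_le_mul_of_nonneg_right h5 (norm_nonneg (b - a))]
  · have h6 : (2 * r + L) ^ 2 ≤ ‖(b - a) + (a - θ)‖ ^ 2 :=
      pow_le_pow_left₀ (by linarith) h2 2
    rw [norm_add_sq_real, real_inner_comm] at h6
    have h7 : ‖a - θ‖ ^ 2 ≤ L ^ 2 := pow_le_pow_left₀ (norm_nonneg _) hL 2
    nlinarith

/-- Replaces the data-dependent direction `b - a` by the fixed `θ' - θ`. The loss `5ε` is `3ε` from
`(1 - 2ε)(1/2 - 2ε)` and `2ε` from the change of direction, which is where `‖w‖ ≤ D` enters. -/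
theorem mul_norm_sq_le_inner_of_nearer {θ θ' w a b : E} {ε D : ℝ} (hε : 0 ≤ ε) (hε' : ε ≤ 1 / 8)
    (hD : D ≤ ‖θ' - θ‖) (ha : ‖a - θ‖ ≤ ε * D) (hb : ‖b - θ'‖ ≤ ε * D) (hw : ‖w‖ ≤ D)
    (h : ‖θ + w - b‖ ^ 2 ≤ ‖θ + w - a‖ ^ 2) :
    (1 / 2 - 5 * ε) * ‖θ' - θ‖ ^ 2 ≤ inner ℝ (θ' - θ) w := by
  have h1 := norm_sq_le_inner_of_nearer h
  have hVe : b - a = (θ' - θ) + ((b - θ') - (a - θ)) := by abel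
  have hu : ‖(b - θ') - (a - θ)‖ ≤ 2 * ε * D := by linarith [norm_sub_le (b - θ') (a - θ)]
  have hDD : ε * D ≤ ε * ‖θ' - θ‖ := mul_le_mul_of_nonneg_left hD hε
  have hD0 : 0 ≤ D := (norm_nonneg _).trans hw
  set x := ‖θ' - θ‖ with hx
  have hV : (1 - 2 * ε) * x ≤ ‖b - a‖ := by
    have : θ' - θ = (b - a) - ((b - θ') - (a - θ)) := by abel
    have h2 := norm_sub_le (b - a) ((b - θ') - (a - θ))
    rw [← this, ← hx] at h2
    linarith
  have h4 := abs_le.1 (abs_real_inner_le_norm (a - θ) (b - a))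
  have h5 : inner ℝ w (b - a) ≤ inner ℝ (θ' - θ) w + 2 * ε * x ^ 2 := by
    rw [hVe, inner_add_right, real_inner_comm]
    have h6 := (abs_le.1 (abs_real_inner_le_norm w ((b - θ') - (a - θ)))).2
    have h7 : ‖w‖ * ‖(b - θ') - (a - θ)‖ ≤ x * (2 * ε * x) :=
      mul_le_mul (hw.trans hD) (by linarith) (norm_nonneg _) (norm_nonneg _)
    nlinarith
  have hx0 : 0 ≤ x := norm_nonneg _
  have h8 : ‖a - θ‖ * ‖b - a‖ ≤ ε * x * ‖b - a‖ :=
    mul_le_mul_of_nonneg_right (by linarith) (norm_nonneg _)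
  have h9 : (1 - 2 * ε) * x * ((1 / 2 - 2 * ε) * x) ≤ ‖b - a‖ * (‖b - a‖ / 2 - ε * x) := by
    apply mul_le_mul hV _ _ (norm_nonneg _)
    · linarith
    · have : 0 ≤ 1 / 2 - 2 * ε := by linarith
      positivity
  nlinarith [mul_nonneg (sq_nonneg ε) (sq_nonneg x)]

end Geometry

/-! ### One iteration: from centers to labels and back. -/

section Step

variable {n m k d : ℕ} {σ : ℝ} {θ : Fin k → EuclideanSpace ℝ (Fin d)} {z : Fin n → Fin k}
  {w : Fin n → EuclideanSpace ℝ (Fin d)} {x : Fin m → EuclideanSpace ℝ (Fin d)}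

/-- All points moved from `g` to `h` share the direction `c h - c g`, so `|S| r ≤ ‖∑ w i‖`; the
subset bound, linear in `|S|`, then limits `|S|`. -/
theorem card_misassigned_mul_sq_le {c : Fin k → EuclideanSpace ℝ (Fin d)}
    {lab : Fin n ⊕ Fin m → Fin k} {L r Δ : ℝ} {g h : Fin k}
    (hsum : ∀ S ⊆ trueCluster z g,
      ‖∑ i ∈ S, w i‖ ^ 2 ≤ 8 * σ ^ 2 * S.card * ((trueCluster z g).card + d))
    (hlab : ∀ i h, ‖dataset θ z w x i - c (lab i)‖ ^ 2 ≤ ‖dataset θ z w x i - c h‖ ^ 2)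
    (hc : ∀ h, ‖c h - θ h‖ ≤ L) (hr : 0 < r) (hL : 2 * (L + r) ≤ Δ) (hgh : Δ ≤ ‖θ h - θ g‖) :
    ((Finset.univ.filter fun i : Fin n => z i = g ∧ lab (Sum.inl i) = h).card : ℝ) * r ^ 2 ≤
      8 * σ ^ 2 * (trueSize z g + d) := by
  set S := Finset.univ.filter fun i : Fin n => z i = g ∧ lab (Sum.inl i) = h with hS
  have hST : S ⊆ trueCluster z g := by
    intro i hi
    simp only [hS, trueCluster, Finset.mem_filter, Finset.mem_univ, true_and] at hi ⊢
    exact hi.1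
  have hmem : ∀ i ∈ S, 0 < ‖c h - c g‖ ∧ r * ‖c h - c g‖ ≤ inner ℝ (w i) (c h - c g) := by
    intro i hi
    simp only [hS, Finset.mem_filter, Finset.mem_univ, true_and] at hi
    have h1 := hlab (Sum.inl i) g
    rw [hi.2] at h1
    simp only [dataset, Sum.elim_inl, hi.1] at h1
    exact mul_norm_le_inner_of_nearer (hc g) (hc h) hr (hL.trans hgh) h1
  have h8 : 0 ≤ 8 * σ ^ 2 * ((trueSize z g : ℝ) + d) := by positivity
  rcases S.eq_empty_or_nonempty with h0 | ⟨i₀, hi₀⟩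
  · rw [h0]; simpa using h8
  have hV := (hmem i₀ hi₀).1
  have hc0 : (0 : ℝ) < S.card := by exact_mod_cast Finset.card_pos.2 ⟨i₀, hi₀⟩
  have h2 : S.card * (r * ‖c h - c g‖) ≤ ‖∑ i ∈ S, w i‖ * ‖c h - c g‖ := by
    refine le_trans ?_ (real_inner_le_norm _ _)
    rw [sum_inner, ← nsmul_eq_mul]
    exact Finset.card_nsmul_le_sum _ _ _ fun i hi => (hmem i hi).2
  have h3 : S.card * r ≤ ‖∑ i ∈ S, w i‖ := by
    refine le_of_mul_le_mul_right ?_ hV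
    linarith
  have h4 := (pow_le_pow_left₀ (by positivity) h3 2).trans (hsum S hST)
  refine le_of_mul_le_mul_left ?_ hc0
  rw [← trueSize] at h4
  linarith

theorem sum_trueSize (z : Fin n → Fin k) : ∑ g, trueSize z g = n := by
  have := Finset.card_eq_sum_card_fiberwise (s := (Finset.univ : Finset (Fin n)))
    (t := (Finset.univ : Finset (Fin k))) (f := z) fun i _ => by simp
  simpa [trueSize, trueCluster] using this.symm

theorem card_mislabelled_le_sum (z : Fin n → Fin k) (lab : Fin n ⊕ Fin m → Fin k) (h : Fin k) :
    (mislabelled z lab h).card ≤ ∑ g ∈ Finset.univ.erase h,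
      ((Finset.univ.filter fun i : Fin n => z i = g ∧ lab (Sum.inl i) = h).card +
        (Finset.univ.filter fun i : Fin n => z i = h ∧ lab (Sum.inl i) = g).card) := by
  have hsub : mislabelled z lab h ⊆ (Finset.univ.erase h).biUnion fun g =>
      (Finset.univ.filter fun i : Fin n => z i = g ∧ lab (Sum.inl i) = h) ∪
        (Finset.univ.filter fun i : Fin n => z i = h ∧ lab (Sum.inl i) = g) := by
    intro i hi
    simp only [mislabelled, Finset.mem_filter, Finset.mem_univ, true_and, Finset.mem_biUnion,
      Finset.mem_union, Finset.mem_erase, and_true] at hi ⊢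
    by_cases h1 : z i = h
    · exact ⟨lab (Sum.inl i), fun h2 => hi (by simp [h1, h2]), Or.inr ⟨h1, rfl⟩⟩
    · refine ⟨z i, h1, Or.inl ⟨rfl, ?_⟩⟩
      by_contra h2
      exact hi (by simp [h1, h2])
  refine (Finset.card_le_card hsub).trans (Finset.card_biUnion_le.trans ?_)
  exact Finset.sum_le_sum fun g _ => Finset.card_union_le _ _

theorem card_mislabelled_mul_sq_le {c : Fin k → EuclideanSpace ℝ (Fin d)}
    {lab : Fin n ⊕ Fin m → Fin k} {L r Δ : ℝ}
    (hsum : ∀ g, ∀ S ⊆ trueCluster z g,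
      ‖∑ i ∈ S, w i‖ ^ 2 ≤ 8 * σ ^ 2 * S.card * ((trueCluster z g).card + d))
    (hlab : ∀ i h, ‖dataset θ z w x i - c (lab i)‖ ^ 2 ≤ ‖dataset θ z w x i - c h‖ ^ 2)
    (hc : ∀ h, ‖c h - θ h‖ ≤ L) (hr : 0 < r) (hL : 2 * (L + r) ≤ Δ)
    (hΔ : ∀ g h, g ≠ h → Δ ≤ ‖θ g - θ h‖) (h : Fin k) :
    ((mislabelled z lab h).card : ℝ) * r ^ 2 ≤
      8 * σ ^ 2 * (n + k * trueSize z h + 2 * k * d) := by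
  have h1 : ((mislabelled z lab h).card : ℝ) ≤ ∑ g ∈ Finset.univ.erase h,
      (((Finset.univ.filter fun i : Fin n => z i = g ∧ lab (Sum.inl i) = h).card : ℝ) +
        (Finset.univ.filter fun i : Fin n => z i = h ∧ lab (Sum.inl i) = g).card) := by
    exact_mod_cast card_mislabelled_le_sum z lab h
  calc ((mislabelled z lab h).card : ℝ) * r ^ 2
      ≤ ∑ g ∈ Finset.univ.erase h,
        (8 * σ ^ 2 * (trueSize z g + d) + 8 * σ ^ 2 * (trueSize z h + d)) := by
        refine (mul_le_mul_of_nonneg_right h1 (sq_nonneg r)).trans ?_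
        rw [Finset.sum_mul]
        refine Finset.sum_le_sum fun g hg => ?_
        have hne := Finset.ne_of_mem_erase hg
        rw [add_mul]
        exact add_le_add
          (card_misassigned_mul_sq_le (hsum g) hlab hc hr hL (hΔ h g hne.symm))
          (card_misassigned_mul_sq_le (hsum h) hlab hc hr hL (hΔ g h hne))
    _ ≤ ∑ g : Fin k, (8 * σ ^ 2 * (trueSize z g + d) + 8 * σ ^ 2 * (trueSize z h + d)) :=
        Finset.sum_le_sum_of_subset_of_nonneg (Finset.erase_subset _ _)
          fun _ _ _ => by positivity
    _ = 8 * σ ^ 2 * (n + k * trueSize z h + 2 * k * d) := by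
        have : (∑ g, (trueSize z g : ℝ)) = n := by exact_mod_cast sum_trueSize z
        simp only [← mul_add, ← Finset.mul_sum, Finset.sum_add_distrib, this, Finset.sum_const,
          Finset.card_univ, Fintype.card_fin, nsmul_eq_mul]
        ring

theorem card_mislabelled_le {c : Fin k → EuclideanSpace ℝ (Fin d)}
    {lab : Fin n ⊕ Fin m → Fin k} {L r Δ α δ : ℝ}
    (hsum : ∀ g, ∀ S ⊆ trueCluster z g,
      ‖∑ i ∈ S, w i‖ ^ 2 ≤ 8 * σ ^ 2 * S.card * ((trueCluster z g).card + d))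
    (hlab : ∀ i h, ‖dataset θ z w x i - c (lab i)‖ ^ 2 ≤ ‖dataset θ z w x i - c h‖ ^ 2)
    (hc : ∀ h, ‖c h - θ h‖ ≤ L) (hr : 0 < r) (hL : 2 * (L + r) ≤ Δ)
    (hΔ : ∀ g h, g ≠ h → Δ ≤ ‖θ g - θ h‖) (hn : 0 < n) (hα : 0 < α) (hδ : 0 < δ)
    (hkα : k * α ≤ 1) (hnα : ∀ h, n * α ≤ trueSize z h)
    (hrσ : 48 * σ ^ 2 * (1 + (d : ℝ) * k / n) ≤ α * δ * r ^ 2) (h : Fin k) :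
    ((mislabelled z lab h).card : ℝ) ≤ δ / 2 * trueSize z h := by
  have h1 := card_mislabelled_mul_sq_le hsum hlab hc hr hL hΔ h
  have hn' : (0 : ℝ) < n := by exact_mod_cast hn
  have hN := hnα h
  -- Each summand is charged to the cluster `h` by `nα ≤ n*_h` and `kα ≤ 1`.
  have h2 : α * (n + k * trueSize z h + 2 * k * d) ≤
      2 * trueSize z h * (1 + (d : ℝ) * k / n) := by
    have h3 : k * α * (trueSize z h : ℝ) ≤ 1 * trueSize z h :=
      mul_le_mul_of_nonneg_right hkα (by positivity)
    have h4 : α * (k * d) ≤ trueSize z h * ((d : ℝ) * k / n) := by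
      have : α * (k * d) = n * α * ((d : ℝ) * k / n) := by field_simp
      rw [this]
      exact mul_le_mul_of_nonneg_right hN (by positivity)
    linarith
  have h5 : (mislabelled z lab h).card * (α * r ^ 2) ≤
      δ / 2 * trueSize z h * (α * r ^ 2) := by
    calc (mislabelled z lab h).card * (α * r ^ 2)
        ≤ 8 * σ ^ 2 * (α * (n + k * trueSize z h + 2 * k * d)) := by
          have := mul_le_mul_of_nonneg_left h1 hα.le
          linarith
      _ ≤ 8 * σ ^ 2 * (2 * trueSize z h * (1 + (d : ℝ) * k / n)) :=
          mul_le_mul_of_nonneg_left h2 (by positivity)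
      _ = trueSize z h / 3 * (48 * σ ^ 2 * (1 + (d : ℝ) * k / n)) := by ring
      _ ≤ trueSize z h / 3 * (α * δ * r ^ 2) := mul_le_mul_of_nonneg_left hrσ (by positivity)
      _ ≤ δ / 2 * trueSize z h * (α * r ^ 2) := by
          have : 0 ≤ trueSize z h * (α * δ * r ^ 2) := by positivity
          linarith
  exact le_of_mul_le_mul_right h5 (by positivity)

/-- Once the centers are moderately accurate, all later ones are accurate. -/
theorem norm_sub_le_of_isRun {lab : ℕ → Fin n ⊕ Fin m → Fin k}
    {c : ℕ → Fin k → EuclideanSpace ℝ (Fin d)} {L r Δ α δ ε : ℝ}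
    (hsum : ∀ g, ∀ S ⊆ trueCluster z g,
      ‖∑ i ∈ S, w i‖ ^ 2 ≤ 8 * σ ^ 2 * S.card * ((trueCluster z g).card + d))
    (hsq : ∀ g, ∑ i ∈ trueCluster z g, ‖w i‖ ^ 2 ≤ 8 * σ ^ 2 * d * (trueCluster z g).card)
    (hrun : IsRun (dataset θ z w x) lab c)
    (hc : ∀ h, ‖c 0 h - θ h‖ ≤ L) (hr : 0 < r) (hL : 2 * (L + r) ≤ Δ)
    (hΔ0 : 0 < Δ) (hΔ : ∀ g h, g ≠ h → Δ ≤ ‖θ g - θ h‖) (hn : 0 < n) (hα : 0 < α) (hδ : 0 < δ)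
    (hkα : k * α ≤ 1) (hnα : ∀ h, n * α ≤ trueSize z h)
    (hm : (m : ℝ) ≤ n * α * (1 - δ)) (hδ1 : δ ≤ 1)
    (hrσ : 48 * σ ^ 2 * (1 + (d : ℝ) * k / n) ≤ α * δ * r ^ 2)
    (hΔσ : 768 * σ ^ 2 * (1 + (d : ℝ) * k / n) ≤ α * δ * Δ ^ 2)
    (hε : 0 ≤ ε) (hε' : ε ≤ 1 / 4) (hεσ : 32 * σ ^ 2 * d ≤ δ * (ε * Δ) ^ 2)
    (s : ℕ) (h : Fin k) : ‖c (s + 1) h - θ h‖ ≤ ε * Δ := by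
  have step : ∀ s {L r : ℝ}, (∀ h, ‖c s h - θ h‖ ≤ L) → 0 < r → 2 * (L + r) ≤ Δ →
      48 * σ ^ 2 * (1 + (d : ℝ) * k / n) ≤ α * δ * r ^ 2 →
      ∀ h, ‖c (s + 1) h - θ h‖ ≤ ε * Δ := by
    intro s L r hc hr hL hrσ h
    have h1 := card_mislabelled_le hsum (hrun.assign s) hc hr hL hΔ hn hα hδ hkα hnα hrσ h
    have h2 := mul_norm_sub_sq_le_of_mislabelled θ z w x (lab (s + 1)) h _ (hrun.update s h)
      (δ := δ) (by
        refine hm.trans ?_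
        rw [mul_comm (1 - δ)]
        exact mul_le_mul_of_nonneg_right (hnα h) (by linarith)) h1
    have h3 := h2.trans (hsq h)
    rw [← trueSize] at h3
    have hn' : (0 : ℝ) < n := by exact_mod_cast hn
    have hN : (0 : ℝ) < trueSize z h := lt_of_lt_of_le (by positivity) (hnα h)
    have h4 : δ / 4 * ‖c (s + 1) h - θ h‖ ^ 2 ≤ 8 * σ ^ 2 * d := by
      refine le_of_mul_le_mul_right ?_ hN
      linarith
    have h5 : δ * ‖c (s + 1) h - θ h‖ ^ 2 ≤ δ * (ε * Δ) ^ 2 := by linarith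
    exact (sq_le_sq₀ (norm_nonneg _) (by positivity)).1 (le_of_mul_le_mul_left h5 hδ)
  induction s generalizing h with
  | zero => exact step 0 hc hr hL hrσ h
  | succ s ih =>
    -- Now `L = ε Δ ≤ Δ/4`, so the radius `Δ/4` is available; `768 = 48 · 4²`.
    refine step (s + 1) ih (r := Δ / 4) (by positivity) ?_ ?_ h
    · nlinarith
    · rw [div_pow]; linarith

/-- The pairs of a point and a wrong label that concern the cluster `h`. -/
def wrongPairs (z : Fin n → Fin k) (h : Fin k) : Finset (Fin n × Fin k) :=
  Finset.univ.filter fun a => (z a.1 = h ∨ a.2 = h) ∧ a.2 ≠ z a.1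

/-- The errors for which a point may be closer to a wrong center than to its own one, even if all
centers are known up to `ε Δ`. -/
def confusing (θ : Fin k → EuclideanSpace ℝ (Fin d)) (z : Fin n → Fin k) (ε Δ : ℝ)
    (a : Fin n × Fin k) : Set (EuclideanSpace ℝ (Fin d)) :=
  {v | (1 / 2 - 5 * ε) * ‖θ a.2 - θ (z a.1)‖ ^ 2 ≤ inner ℝ (θ a.2 - θ (z a.1)) v ∨ Δ ≤ ‖v‖}

theorem card_wrongPairs_le (z : Fin n → Fin k) (h : Fin k) :
    (wrongPairs z h).card ≤ k * trueSize z h + n := by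
  have hsub : wrongPairs z h ⊆ (trueCluster z h) ×ˢ (Finset.univ : Finset (Fin k)) ∪
      (Finset.univ : Finset (Fin n)) ×ˢ {h} := by
    intro a ha
    simp only [wrongPairs, Finset.mem_filter, Finset.mem_univ, true_and] at ha
    simp only [trueCluster, Finset.mem_union, Finset.mem_product, Finset.mem_filter,
      Finset.mem_univ, true_and, and_true, Finset.mem_singleton]
    exact ha.1
  refine (Finset.card_le_card hsub).trans ((Finset.card_union_le _ _).trans_eq ?_)
  rw [Finset.card_product, Finset.card_product]
  simp [trueSize, mul_comm]

open Classical in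
-- The bounding count no longer involves the run or the added points, so its probability can be
-- estimated once for all of them.
theorem card_mislabelled_le_card_confusing {c : Fin k → EuclideanSpace ℝ (Fin d)}
    {lab : Fin n ⊕ Fin m → Fin k} {Δ ε : ℝ}
    (hlab : ∀ i h, ‖dataset θ z w x i - c (lab i)‖ ^ 2 ≤ ‖dataset θ z w x i - c h‖ ^ 2)
    (hc : ∀ h, ‖c h - θ h‖ ≤ ε * Δ) (hΔ : ∀ g h, g ≠ h → Δ ≤ ‖θ g - θ h‖)
    (hε : 0 ≤ ε) (hε' : ε ≤ 1 / 8) (h : Fin k) :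
    (mislabelled z lab h).card ≤
      ((wrongPairs z h).filter fun a => w a.1 ∈ confusing θ z ε Δ a).card := by
  refine Finset.card_le_card_of_injOn (fun i => (i, lab (Sum.inl i))) ?_ ?_
  · intro i hi
    have hi : ¬(z i = h ↔ lab (Sum.inl i) = h) := by simpa [mislabelled] using hi
    have hne : lab (Sum.inl i) ≠ z i := by
      intro h1; rw [h1] at hi; exact hi Iff.rfl
    simp only [Finset.coe_filter, Set.mem_ofPred_eq, wrongPairs, Finset.mem_filter,
      Finset.mem_univ, true_and]
    refine ⟨⟨by tauto, hne⟩, ?_⟩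
    by_cases hw : Δ ≤ ‖w i‖
    · exact Or.inr hw
    · have h1 := hlab (Sum.inl i) (z i)
      simp only [dataset, Sum.elim_inl] at h1
      exact Or.inl (mul_norm_sq_le_inner_of_nearer hε hε' (hΔ _ _ hne) (hc _) (hc _)
        (not_le.1 hw).le h1)
  · intro i _ j _ hij
    exact (Prod.ext_iff.1 hij).1

end Step

/-! ### Quantiles. -/

section Quantile

/-- Right continuity of the distribution function; the lower counterpart below passes to a left
limit, hence the open half-line there. -/
theorem le_cdf_of_quantile_le (ν : Measure ℝ) {u Q : ℝ}
    (h : quantile ν u ≤ (Q : EReal)) : u ≤ cdf ν Q := by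
  by_contra! hlt
  have hc : Filter.Tendsto (cdf ν) (nhdsWithin Q (Set.Ioi Q)) (nhds (cdf ν Q)) :=
    ((cdf ν).right_continuous Q).mono Set.Ioi_subset_Ici_self
  obtain ⟨y, hy, hQy⟩ := ((hc.eventually (gt_mem_nhds hlt)).and self_mem_nhdsWithin).exists
  have h1 : (y : EReal) ≤ quantile ν u := by
    refine le_sInf ?_
    rintro _ ⟨x, hx, rfl⟩
    rw [EReal.coe_le_coe_iff]
    by_contra! hxy
    exact absurd (hx.trans (monotone_cdf ν hxy.le)) (not_le.2 hy)
  exact absurd (h1.trans h) (not_le.2 (EReal.coe_lt_coe_iff.2 hQy))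

theorem measureReal_Iio_le_of_le_quantile (ν : Measure ℝ) [IsProbabilityMeasure ν] {u Q : ℝ}
    (h : (Q : EReal) ≤ quantile ν u) : ν.real (Set.Iio Q) ≤ u := by
  have hlt : ∀ x < Q, cdf ν x < u := by
    intro x hx
    by_contra! hux
    have h1 : quantile ν u ≤ (x : EReal) := sInf_le ⟨x, hux, rfl⟩
    exact absurd (h.trans h1) (not_le.2 (EReal.coe_lt_coe_iff.2 hx))
  have hlim : Function.leftLim (cdf ν) Q ≤ u := by
    refine le_of_tendsto ((monotone_cdf ν).tendsto_leftLim Q) ?_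
    filter_upwards [self_mem_nhdsWithin] with x hx using (hlt x hx).le
  have h0 : 0 ≤ Function.leftLim (cdf ν) Q :=
    (cdf_nonneg ν (Q - 1)).trans ((monotone_cdf ν).le_leftLim (by linarith))
  have h2 := (cdf ν).measure_Iio (tendsto_cdf_atBot ν) Q
  rw [measure_cdf, sub_zero] at h2
  rw [measureReal_def, h2, ENNReal.toReal_ofReal h0]
  exact hlim

theorem le_toReal_of_abs_le {q : EReal} {M : ℝ≥0∞} (hM : M ≠ ⊤) (h : q.abs ≤ M) :
    ((-M.toReal : ℝ) : EReal) ≤ q ∧ q ≤ (M.toReal : EReal) := by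
  induction q with
  | bot => simp [hM] at h
  | top => simp [hM] at h
  | coe r =>
    rw [EReal.abs_def, ENNReal.ofReal_le_iff_le_toReal hM, abs_le] at h
    exact ⟨EReal.coe_le_coe_iff.2 h.1, EReal.coe_le_coe_iff.2 h.2⟩

variable {Ω : Type*} [MeasurableSpace Ω] {μ : Measure Ω} [IsProbabilityMeasure μ] {n k d : ℕ}
  {w : Fin n → Ω → EuclideanSpace ℝ (Fin d)} {z : Fin n → Fin k} {h : Fin k} {p : ℝ}

theorem le_measureReal_of_maxQuantile_ne_top (hw : ∀ i, Measurable (w i))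
    (hM : maxQuantile μ w z h p ≠ ⊤) {i : Fin n} (hi : i ∈ trueCluster z h) (j : Fin d) :
    1 / 2 + p ≤ μ.real (w i ⁻¹' {v | v j ≤ (maxQuantile μ w z h p).toReal}) ∧
      1 / 2 + p ≤ μ.real (w i ⁻¹' {v | -(maxQuantile μ w z h p).toReal ≤ v j}) := by
  have hwj : Measurable fun ω => w i ω j := by have := hw i; fun_prop
  set ν := μ.map fun ω => w i ω j with hν
  have : IsProbabilityMeasure ν := Measure.isProbabilityMeasure_map hwj.aemeasurable
  have hmax : max (quantile ν (1 / 2 + p)).abs (quantile ν (1 / 2 - p)).abs ≤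
      maxQuantile μ w z h p :=
    (le_iSup (fun j => max (quantile (μ.map fun ω => w i ω j) (1 / 2 + p)).abs
      (quantile (μ.map fun ω => w i ω j) (1 / 2 - p)).abs) j).trans
      (le_iSup₂ (f := fun i (_ : i ∈ trueCluster z h) => ⨆ j : Fin d,
        max (quantile (μ.map fun ω => w i ω j) (1 / 2 + p)).abs
          (quantile (μ.map fun ω => w i ω j) (1 / 2 - p)).abs) i hi)
  have h1 := le_cdf_of_quantile_le ν (le_toReal_of_abs_le hM ((le_max_left _ _).trans hmax)).2
  have h2 := measureReal_Iio_le_of_le_quantile ν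
    (le_toReal_of_abs_le hM ((le_max_right _ _).trans hmax)).1
  constructor
  · rw [cdf_eq_real, hν, map_measureReal_apply hwj measurableSet_Iic] at h1
    exact h1
  · have h3 : ν.real (Set.Ici (-(maxQuantile μ w z h p).toReal)) =
        1 - ν.real (Set.Iio (-(maxQuantile μ w z h p).toReal)) := by
      rw [← probReal_compl_eq_one_sub measurableSet_Iio, Set.compl_Iio]
    rw [hν, map_measureReal_apply hwj measurableSet_Ici] at h3
    change 1 / 2 + p ≤ μ.real ((fun ω => w i ω j) ⁻¹' Set.Ici _)
    rw [h3]
    linarith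

end Quantile

/-! ### Accuracy of the median from quantile counts. -/

section Median

variable {n m k d : ℕ} {θ : Fin k → EuclideanSpace ℝ (Fin d)} {z : Fin n → Fin k}
  {w : Fin n → EuclideanSpace ℝ (Fin d)} {x : Fin m → EuclideanSpace ℝ (Fin d)}

open Classical in
-- Were a coordinate of the error above `Q`, all cluster points with noise at most `Q` would lie
-- strictly below the median, too many for `card_trueCluster_filter_le`; likewise below `-Q`.
theorem norm_sub_sq_le_of_isCoordMedian {lab : Fin n ⊕ Fin m → Fin k} {h : Fin k}
    {c : EuclideanSpace ℝ (Fin d)} (hc : IsCoordMedian (labelled lab h) (dataset θ z w x) c) {Q : ℝ}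
    (hup : ∀ j, trueSize z h + (mislabelled z lab h).card + m <
      2 * ((trueCluster z h).filter fun i => w i ∈ {v | v j ≤ Q}).card)
    (hlow : ∀ j, trueSize z h + (mislabelled z lab h).card + m <
      2 * ((trueCluster z h).filter fun i => w i ∈ {v | -Q ≤ v j}).card) :
    ‖c - θ h‖ ^ 2 ≤ d * Q ^ 2 := by
  have hj : ∀ j, (c - θ h) j ^ 2 ≤ Q ^ 2 := by
    intro j
    rw [PiLp.sub_apply]
    refine sq_le_sq' ?_ ?_
    · by_contra! hlt
      refine absurd (lt_of_lt_of_le (hlow j) ((Nat.mul_le_mul_left 2 (Finset.card_le_card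
        fun i hi => ?_)).trans (card_trueCluster_filter_le z lab h _ (hc j).2))) (lt_irrefl _)
      rw [Finset.mem_filter] at hi
      refine Finset.mem_filter.2 ⟨hi.1, ?_⟩
      have hz : z i = h := by simpa [trueCluster] using hi.1
      have hi2 := hi.2
      simp only [Set.mem_ofPred_eq, dataset, Sum.elim_inl, PiLp.add_apply, hz] at hi2 ⊢
      linarith
    · by_contra! hlt
      refine absurd (lt_of_lt_of_le (hup j) ((Nat.mul_le_mul_left 2 (Finset.card_le_card
        fun i hi => ?_)).trans (card_trueCluster_filter_le z lab h _ (hc j).1))) (lt_irrefl _)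
      rw [Finset.mem_filter] at hi
      refine Finset.mem_filter.2 ⟨hi.1, ?_⟩
      have hz : z i = h := by simpa [trueCluster] using hi.1
      have hi2 := hi.2
      simp only [Set.mem_ofPred_eq, dataset, Sum.elim_inl, PiLp.add_apply, hz] at hi2 ⊢
      linarith
  rw [EuclideanSpace.norm_sq_eq]
  simp only [Real.norm_eq_abs, sq_abs]
  refine (Finset.sum_le_card_nsmul _ _ _ fun j _ => hj j).trans_eq ?_
  simp

end Median

/-! ### Union bounds and confusing noise. -/

section Events

variable {Ω : Type*} [MeasurableSpace Ω] {μ : Measure Ω}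

theorem measure_exists_fin_le {k : ℕ} (P : Fin k → Ω → Prop) {e : ℝ}
    (h : ∀ g, μ {ω | P g ω} ≤ ENNReal.ofReal e) :
    μ {ω | ∃ g, P g ω} ≤ ENNReal.ofReal (k * e) := by
  have : {ω | ∃ g, P g ω} = ⋃ g, {ω | P g ω} := by ext; simp
  rw [this]
  refine (measure_iUnion_fintype_le _ _).trans ((Finset.sum_le_sum fun g _ => h g).trans_eq ?_)
  rw [Finset.sum_const, Finset.card_univ, Fintype.card_fin, nsmul_eq_mul,
    ENNReal.ofReal_mul (by positivity), ENNReal.ofReal_natCast]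

theorem measure_or_le {P Q : Ω → Prop} {a b : ℝ} (ha : 0 ≤ a) (hb : 0 ≤ b)
    (hP : μ {ω | P ω} ≤ ENNReal.ofReal a) (hQ : μ {ω | Q ω} ≤ ENNReal.ofReal b) :
    μ {ω | P ω ∨ Q ω} ≤ ENNReal.ofReal (a + b) := by
  rw [ENNReal.ofReal_add ha hb]
  exact (measure_union_le {ω | P ω} {ω | Q ω}).trans (add_le_add hP hQ)

/-- The bad event is bounded in outer measure and replaced by its measurable hull, so its
measurability need not be checked. -/
theorem exists_measurableSet_forall_not [IsProbabilityMeasure μ] {P : Ω → Prop} {a : ℝ}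
    (ha : 0 ≤ a) (hP : μ {ω | P ω} ≤ ENNReal.ofReal a) :
    ∃ G : Set Ω, MeasurableSet G ∧ 1 - a ≤ μ.real G ∧ ∀ ω ∈ G, ¬P ω := by
  refine ⟨(toMeasurable μ {ω | P ω})ᶜ, (measurableSet_toMeasurable _ _).compl, ?_, ?_⟩
  · rw [probReal_compl_eq_one_sub (measurableSet_toMeasurable _ _), measureReal_def,
      measure_toMeasurable]
    have := ENNReal.toReal_mono ENNReal.ofReal_ne_top hP
    rw [ENNReal.toReal_ofReal ha] at this
    linarith
  · intro ω hω h
    exact hω (subset_toMeasurable μ {ω | P ω} h)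

variable [IsProbabilityMeasure μ] {n k d : ℕ} {σ : ℝ} {θ : Fin k → EuclideanSpace ℝ (Fin d)}
  {z : Fin n → Fin k} {w : Fin n → Ω → EuclideanSpace ℝ (Fin d)}

theorem measurableSet_confusing (ε Δ : ℝ) (a : Fin n × Fin k) :
    MeasurableSet (confusing θ z ε Δ a) := by
  have h1 : Measurable fun v : EuclideanSpace ℝ (Fin d) => inner ℝ (θ a.2 - θ (z a.1)) v := by
    fun_prop
  exact (measurableSet_le measurable_const h1).union
    (measurableSet_le measurable_const measurable_norm)

/-- The bisector alternative has exponent at least `2(1/2 - 5ε)² SNR² ≥ (1/2 - 10ε) SNR²`. Long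
noise costs `exp(d/2 - SNR²)`, at most `exp(-SNR²/2)` since `d ≤ SNR²`. -/
theorem measure_confusing_le (hw : IsSubGaussianNoise μ σ w) (hσ : 0 < σ) {ε Δ r : ℝ}
    (hε' : ε ≤ 1 / 20) (hΔ0 : 0 < Δ)
    (hr : r + 10 * ε ≤ 1 / 2) (hr' : r ≤ 1 / 2) (hΔ : ∀ g h, g ≠ h → Δ ≤ ‖θ g - θ h‖)
    (hd : (d : ℝ) ≤ (Δ / (2 * σ)) ^ 2) {a : Fin n × Fin k} (ha : a.2 ≠ z a.1) :
    μ (w a.1 ⁻¹' confusing θ z ε Δ a) ≤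
      ENNReal.ofReal (2 * Real.exp (-(r * (Δ / (2 * σ)) ^ 2))) := by
  have hD := hΔ _ _ ha
  have h1 := hw.measure_inner_ge_le hσ a.1 (θ a.2 - θ (z a.1))
    (show 0 < 1 / 2 - 5 * ε by linarith)
  have h2 := measure_norm_sq_ge_le (s := σ ^ 2) (by positivity) (hw.measurable a.1)
    (hw.lintegral_exp_inner_le a.1) ((Δ / (2 * σ)) ^ 2)
  have hx : 4 * σ ^ 2 * (Δ / (2 * σ)) ^ 2 = Δ ^ 2 := by field_simp; norm_num
  rw [hx] at h2
  have h1' : μ {ω | (1 / 2 - 5 * ε) * ‖θ a.2 - θ (z a.1)‖ ^ 2 ≤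
      inner ℝ (θ a.2 - θ (z a.1)) (w a.1 ω)} ≤
      ENNReal.ofReal (Real.exp (-(r * (Δ / (2 * σ)) ^ 2))) := by
    refine h1.trans (ENNReal.ofReal_le_ofReal (Real.exp_le_exp.2 (neg_le_neg ?_)))
    have h3 : Δ ^ 2 ≤ ‖θ a.2 - θ (z a.1)‖ ^ 2 := pow_le_pow_left₀ hΔ0.le hD 2
    calc r * (Δ / (2 * σ)) ^ 2 ≤ (2 * (1 / 2 - 5 * ε) ^ 2) * (Δ / (2 * σ)) ^ 2 := by
          apply mul_le_mul_of_nonneg_right _ (sq_nonneg _)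
          nlinarith [sq_nonneg ε]
      _ = (1 / 2 - 5 * ε) ^ 2 * Δ ^ 2 / (2 * σ ^ 2) := by field_simp
      _ ≤ _ := by gcongr
  have h2' : μ {ω | Δ ≤ ‖w a.1 ω‖} ≤ ENNReal.ofReal (Real.exp (-(r * (Δ / (2 * σ)) ^ 2))) := by
    refine (measure_mono fun ω hω => ?_).trans (h2.trans
      (ENNReal.ofReal_le_ofReal (Real.exp_le_exp.2 ?_)))
    · exact pow_le_pow_left₀ hΔ0.le hω 2
    · have := mul_le_mul_of_nonneg_right hr' (sq_nonneg (Δ / (2 * σ)))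
      linarith
  have := measure_or_le (Real.exp_pos _).le (Real.exp_pos _).le h1' h2'
  rw [two_mul]
  exact this

end Events

/-! ### Elementary consequences of the model parameters. -/

section Model

variable {n k d : ℕ}

theorem minFraction_le (z : Fin n → Fin k) (h : Fin k) : minFraction z ≤ trueSize z h / n :=
  ciInf_le (Set.finite_range _).bddBelow h

theorem minSeparation_le (θ : Fin k → EuclideanSpace ℝ (Fin d)) {g h : Fin k} (hgh : g ≠ h) :
    minSeparation θ ≤ ‖θ g - θ h‖ :=
  ciInf_le (f := fun p : {p : Fin k × Fin k // p.1 ≠ p.2} => ‖θ p.1.1 - θ p.1.2‖)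
    (Set.finite_range _).bddBelow ⟨(g, h), hgh⟩

theorem pos_of_minFraction_pos {z : Fin n → Fin k} (hk : 2 ≤ k) (hα : 0 < minFraction z) :
    0 < n := by
  rcases Nat.eq_zero_or_pos n with rfl | h
  · have := minFraction_le z ⟨0, by omega⟩
    simp at this
    linarith
  · exact h

theorem mul_minFraction_le {z : Fin n → Fin k} (hn : 0 < n) (h : Fin k) :
    n * minFraction z ≤ trueSize z h := by
  have hn' : (0 : ℝ) < n := by exact_mod_cast hn
  have := minFraction_le z h
  rw [le_div_iff₀ hn'] at this
  linarith

theorem card_mul_minFraction_le_one {z : Fin n → Fin k} (hn : 0 < n) :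
    k * minFraction z ≤ 1 := by
  have hn' : (0 : ℝ) < n := by exact_mod_cast hn
  have h1 : k * (n * minFraction z) ≤ n := by
    have h2 : (∑ g, (trueSize z g : ℝ)) = n := by exact_mod_cast sum_trueSize z
    have h3 := Finset.card_nsmul_le_sum (Finset.univ : Finset (Fin k))
      (fun g => (trueSize z g : ℝ)) _ fun g _ => mul_minFraction_le hn g
    rw [h2] at h3
    simpa using h3
  refine le_of_mul_le_mul_right ?_ hn'
  linarith

theorem sq_mul_le_of_le_mul_sqrt {C δ x α : ℝ} (hC : 0 < C) (hδ : 0 < δ) (hd : 1 ≤ d)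
    (hα : 0 ≤ α) (h : C ≤ √δ * x * √(α / d)) : C ^ 2 * d ≤ α * δ * x ^ 2 := by
  have hd' : (0 : ℝ) < d := by exact_mod_cast hd
  have h1 := pow_le_pow_left₀ hC.le h 2
  rw [mul_pow, mul_pow, Real.sq_sqrt hδ.le, Real.sq_sqrt (by positivity)] at h1
  have h2 : δ * x ^ 2 * (α / d) = α * δ * x ^ 2 / d := by ring
  rwa [h2, le_div_iff₀ hd'] at h1

end Model

/-! ### The two kinds of initialization. -/

section Initialization

variable {n m k d : ℕ} {σ δ : ℝ} {θ : Fin k → EuclideanSpace ℝ (Fin d)} {z : Fin n → Fin k}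
  {w : Fin n → EuclideanSpace ℝ (Fin d)} {x : Fin m → EuclideanSpace ℝ (Fin d)}

theorem exists_radius_of_initCondition {lab₀ : Fin n ⊕ Fin m → Fin k}
    {c₀ : Fin k → EuclideanSpace ℝ (Fin d)}
    (hinit : InitCondition 32 1 δ σ θ z (dataset θ z w x) lab₀ c₀)
    (hsq : ∀ g, ∑ i ∈ trueCluster z g, ‖w i‖ ^ 2 ≤ 8 * σ ^ 2 * d * (trueCluster z g).card)
    (hσ : 0 < σ) (hδ : 0 < δ) (hd : 1 ≤ d) (hn : 0 < n) (hα : 0 < minFraction z)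
    (hα1 : minFraction z ≤ 1) (hΔ : 0 < minSeparation θ)
    (hC : 192 * (1 + (d : ℝ) * k / n) ≤ minFraction z * δ * snr θ σ ^ 2) :
    ∃ L r, (∀ h, ‖c₀ h - θ h‖ ≤ L) ∧ 0 < r ∧ 2 * (L + r) ≤ minSeparation θ ∧
      48 * σ ^ 2 * (1 + (d : ℝ) * k / n) ≤ minFraction z * δ * r ^ 2 := by
  have hd' : (0 : ℝ) < d := by exact_mod_cast hd
  have hn' : (0 : ℝ) < n := by exact_mod_cast hn
  have hxΔ : minSeparation θ = 2 * σ * snr θ σ := by rw [snr]; field_simp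
  set Δ := minSeparation θ with hΔdef
  set α := minFraction z with hαdef
  set y := snr θ σ with hy
  have hy0 : 0 < y := by rw [hy, snr]; positivity
  set D := 1 + (d : ℝ) * k / n with hD
  have hD0 : 0 < D := by positivity
  rcases hinit with ⟨hmed, hH⟩ | hΛ
  -- The constant `32` turns `8σ²d` into `‖c₀ h - θ h‖² ≤ σ² SNR² α/4 ≤ (Δ/4)²`.
  · refine ⟨Δ / 4, Δ / 4, fun h => ?_, by positivity, by linarith, ?_⟩
    · have hN : (0 : ℝ) < trueSize z h := lt_of_lt_of_le (by positivity) (mul_minFraction_le hn h)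
      have h1 := mul_norm_sub_sq_le_of_correctProportion θ z w x lab₀ h _ (hmed h)
        (by positivity) (by exact_mod_cast hN) hH
      have h2 := h1.trans (hsq h)
      rw [← trueSize, mul_pow, Real.sq_sqrt (by positivity)] at h2
      have h3 : 32 / (y ^ 2 * (α / d)) * ‖c₀ h - θ h‖ ^ 2 ≤ 8 * σ ^ 2 * d := by
        refine le_of_mul_le_mul_right ?_ hN
        linarith
      have h4 : 32 / (y ^ 2 * (α / d)) = 32 * d / (y ^ 2 * α) := by field_simp
      rw [h4, div_mul_eq_mul_div, div_le_iff₀ (by positivity)] at h3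
      have h5 : ‖c₀ h - θ h‖ ^ 2 ≤ (Δ / 4) ^ 2 := by
        rw [hxΔ]
        have h6 : 32 * d * ‖c₀ h - θ h‖ ^ 2 ≤ 32 * d * (σ ^ 2 * y ^ 2 / 4 * α) := by linarith
        have h7 := le_of_mul_le_mul_left h6 (by positivity)
        have h8 : σ ^ 2 * y ^ 2 / 4 * α ≤ σ ^ 2 * y ^ 2 / 4 * 1 :=
          mul_le_mul_of_nonneg_left hα1 (by positivity)
        linarith
      exact (sq_le_sq₀ (norm_nonneg _) (by positivity)).1 h5
    · rw [hxΔ]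
      have := mul_le_mul_of_nonneg_left hC (show 0 ≤ σ ^ 2 / 4 by positivity)
      linarith
  · set s := √δ * y * √(α / D) with hs
    have hs0 : 0 < s := by positivity
    have hs2 : s ^ 2 * D = α * δ * y ^ 2 := by
      rw [hs, mul_pow, mul_pow, Real.sq_sqrt hδ.le, Real.sq_sqrt (by positivity)]
      field_simp
    have hb2 : (1 / √s) ^ 2 = 1 / s := by rw [div_pow, Real.sq_sqrt hs0.le, one_pow]
    have hs12 : 12 ≤ s := by
      have : 12 ^ 2 * D ≤ s ^ 2 * D := by rw [hs2]; linarith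
      exact (sq_le_sq₀ (by norm_num) hs0.le).1 (le_of_mul_le_mul_right this hD0)
    -- The margin `1/√s` is the whole radius: as `s² D = α δ SNR²`, one gets `α δ r² = 4σ² D s`, and
    -- `s ≥ 12` gives the required `48σ² D`.
    refine ⟨(1 / 2 - 1 / √s) * Δ, 1 / √s * Δ, fun h => ?_, by positivity, by linarith, ?_⟩
    · have h1 := (le_ciSup (f := fun h => 1 / Δ * ‖c₀ h - θ h‖)
        (Set.finite_range _).bddAbove h).trans hΛ
      rw [div_mul_eq_mul_div, one_mul, div_le_iff₀ hΔ] at h1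
      exact h1
    · rw [mul_pow, hb2, hxΔ]
      have h1 : α * δ * (1 / s * (2 * σ * y) ^ 2) = 4 * σ ^ 2 * (α * δ * y ^ 2) / s := by ring
      rw [h1, ← hs2]
      have h2 : 4 * σ ^ 2 * (s ^ 2 * D) / s = 4 * σ ^ 2 * D * s := by field_simp
      rw [h2]
      have := mul_le_mul_of_nonneg_left hs12 (show 0 ≤ 4 * σ ^ 2 * D by positivity)
      linarith

end Initialization

/-! ### The good event and its probability. -/

section Good

variable {Ω : Type*} [MeasurableSpace Ω] {μ : Measure Ω} [IsProbabilityMeasure μ] {n k d : ℕ}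
  {σ : ℝ} {θ : Fin k → EuclideanSpace ℝ (Fin d)} {z : Fin n → Fin k}
  {w : Fin n → Ω → EuclideanSpace ℝ (Fin d)}

open Classical in
-- There are at most `2 n*_h/α` pairs, each confusing with probability at most `2 exp(-(η + κ)
-- SNR²)`. Markov's inequality spends `η` on the threshold and keeps `κ` for the probability.
theorem measure_card_confusing_ge_le (hw : IsSubGaussianNoise μ σ w) (hσ : 0 < σ)
    {ε Δ α η κ : ℝ} (hε' : ε ≤ 1 / 20) (hΔ0 : 0 < Δ) (hκ : η + κ + 10 * ε ≤ 1 / 2)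
    (hκ' : η + κ ≤ 1 / 2) (hΔ : ∀ g h, g ≠ h → Δ ≤ ‖θ g - θ h‖)
    (hd : (d : ℝ) ≤ (Δ / (2 * σ)) ^ 2) (hn : 0 < n) (hα : 0 < α) (hkα : k * α ≤ 1)
    (hnα : ∀ h, n * α ≤ trueSize z h) (h : Fin k) :
    μ {ω | trueSize z h * Real.exp (-(η * (Δ / (2 * σ)) ^ 2)) ≤
        ((wrongPairs z h).filter fun a => w a.1 ω ∈ confusing θ z ε Δ a).card} ≤
      ENNReal.ofReal (4 / α * Real.exp (-(κ * (Δ / (2 * σ)) ^ 2))) := by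
  set X := (Δ / (2 * σ)) ^ 2 with hX
  have hn' : (0 : ℝ) < n := by exact_mod_cast hn
  have hN : (0 : ℝ) < trueSize z h := lt_of_lt_of_le (by positivity) (hnα h)
  have h1 := measure_card_ge_le μ (wrongPairs z h)
    (fun a => w a.1 ⁻¹' confusing θ z ε Δ a)
    (fun a _ => hw.measurable a.1 (measurableSet_confusing ε Δ a))
    (p := 2 * Real.exp (-((η + κ) * X))) (t := trueSize z h * Real.exp (-(η * X)))
    (by positivity) fun a ha => by
      simp only [wrongPairs, Finset.mem_filter, Finset.mem_univ, true_and] at ha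
      exact measure_confusing_le hw hσ hε' hΔ0 hκ hκ' hΔ hd ha.2
  refine h1.trans (ENNReal.ofReal_le_ofReal ?_)
  have h2 : ((wrongPairs z h).card : ℝ) ≤ 2 / α * trueSize z h := by
    have h3 : ((wrongPairs z h).card : ℝ) ≤ k * trueSize z h + n := by
      exact_mod_cast card_wrongPairs_le z h
    refine h3.trans ?_
    rw [div_mul_eq_mul_div, le_div_iff₀ hα]
    have h4 := mul_le_mul_of_nonneg_right hkα hN.le
    have h5 := hnα h
    linarith
  rw [div_le_iff₀ (by positivity)]
  have h6 : Real.exp (-((η + κ) * X)) = Real.exp (-(κ * X)) * Real.exp (-(η * X)) := by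
    rw [← Real.exp_add]; congr 1; ring
  rw [h6]
  have := mul_le_mul_of_nonneg_right h2
    (show 0 ≤ 2 * (Real.exp (-(κ * X)) * Real.exp (-(η * X))) by positivity)
  refine this.trans_eq ?_
  ring

open Classical in
theorem measure_card_coord_le_le (hw : IsSubGaussianNoise μ σ w) (hn : 1 ≤ n) (h : Fin k) (p : ℝ)
    (hN : 0 < trueSize z h) (j : Fin d) :
    μ {ω | maxQuantile μ w z h p ≠ ⊤ ∧
        ((((trueCluster z h).filter fun i =>
            w i ω ∈ {v | v j ≤ (maxQuantile μ w z h p).toReal}).card : ℝ) ≤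
          (1 / 2 + p) * trueSize z h - √(3 * trueSize z h * Real.log n) ∨
        (((trueCluster z h).filter fun i =>
            w i ω ∈ {v | -(maxQuantile μ w z h p).toReal ≤ v j}).card : ℝ) ≤
          (1 / 2 + p) * trueSize z h - √(3 * trueSize z h * Real.log n))} ≤
      ENNReal.ofReal (2 * ((n : ℝ) ^ 6)⁻¹) := by
  by_cases hM : maxQuantile μ w z h p = ⊤
  · simp [hM]
  have hn' : (0 : ℝ) < n := by exact_mod_cast hn
  have hN' : (0 : ℝ) < trueSize z h := by exact_mod_cast hN
  have hlog : 0 ≤ Real.log n := Real.log_nonneg (by exact_mod_cast hn)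
  -- The deviation `√(3 N log n)` gives `n⁻⁶`; the union over `k ≤ n` clusters and `d` coordinates
  -- then costs a multiple of `(d/n⁴) n⁻¹`.
  have hexp : Real.exp (-(2 * √(3 * trueSize z h * Real.log n) ^ 2 / (trueCluster z h).card)) =
      ((n : ℝ) ^ 6)⁻¹ := by
    rw [← trueSize, Real.sq_sqrt (by positivity), Real.exp_neg]
    congr 1
    have : 2 * (3 * trueSize z h * Real.log n) / trueSize z h = (6 : ℕ) * Real.log n := by
      push_cast; field_simp; ring
    rw [this, Real.exp_nat_mul, Real.exp_log hn']
  have hj : Measurable fun v : EuclideanSpace ℝ (Fin d) => v j := by fun_prop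
  have h1 := hw.measure_card_le_le (A := {v | v j ≤ (maxQuantile μ w z h p).toReal})
    (measurableSet_le hj measurable_const) (trueCluster z h)
    (Real.sqrt_nonneg (3 * trueSize z h * Real.log n))
    (fun i hi => (le_measureReal_of_maxQuantile_ne_top hw.measurable hM hi j).1)
  have h2 := hw.measure_card_le_le (A := {v | -(maxQuantile μ w z h p).toReal ≤ v j})
    (measurableSet_le measurable_const hj) (trueCluster z h)
    (Real.sqrt_nonneg (3 * trueSize z h * Real.log n))
    (fun i hi => (le_measureReal_of_maxQuantile_ne_top hw.measurable hM hi j).2)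
  rw [hexp] at h1 h2
  refine (measure_mono fun ω hω => hω.2).trans
    ((measure_or_le (by positivity) (by positivity) h1 h2).trans_eq ?_)
  rw [two_mul]

open Classical in
theorem exists_good_event (hw : IsSubGaussianNoise μ σ w) (hσ : 0 < σ) (hd1 : 1 ≤ d)
    {ε Δ α η κ : ℝ} (hε' : ε ≤ 1 / 20) (hΔ0 : 0 < Δ) (hκ : η + κ + 10 * ε ≤ 1 / 2)
    (hκ' : η + κ ≤ 1 / 2) (hΔ : ∀ g h, g ≠ h → Δ ≤ ‖θ g - θ h‖)
    (hd : (d : ℝ) ≤ (Δ / (2 * σ)) ^ 2) (hn : 0 < n) (hα : 0 < α) (hkα : k * α ≤ 1)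
    (hnα : ∀ h, n * α ≤ trueSize z h) (p : Fin k → ℝ) :
    ∃ G : Set Ω, MeasurableSet G ∧
      1 - (k * Real.exp (-(n * α)) + (k * Real.exp (-(n * α)) +
        (k * (4 / α * Real.exp (-(κ * (Δ / (2 * σ)) ^ 2))) +
          k * (d * (2 * ((n : ℝ) ^ 6)⁻¹))))) ≤ μ.real G ∧
      ∀ ω ∈ G,
        (∀ g, ∀ S ⊆ trueCluster z g,
          ‖∑ i ∈ S, w i ω‖ ^ 2 ≤ 8 * σ ^ 2 * S.card * ((trueCluster z g).card + d)) ∧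
        (∀ g, ∑ i ∈ trueCluster z g, ‖w i ω‖ ^ 2 ≤ 8 * σ ^ 2 * d * (trueCluster z g).card) ∧
        (∀ h, (((wrongPairs z h).filter fun a => w a.1 ω ∈ confusing θ z ε Δ a).card : ℝ) <
          trueSize z h * Real.exp (-(η * (Δ / (2 * σ)) ^ 2))) ∧
        ∀ h j, maxQuantile μ w z h (p h) ≠ ⊤ →
          (1 / 2 + p h) * trueSize z h - √(3 * trueSize z h * Real.log n) <
            ((trueCluster z h).filter fun i =>
              w i ω ∈ {v | v j ≤ (maxQuantile μ w z h (p h)).toReal}).card ∧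
          (1 / 2 + p h) * trueSize z h - √(3 * trueSize z h * Real.log n) <
            ((trueCluster z h).filter fun i =>
              w i ω ∈ {v | -(maxQuantile μ w z h (p h)).toReal ≤ v j}).card := by
  have hn' : (0 : ℝ) < n := by exact_mod_cast hn
  have hN : ∀ h, (0 : ℝ) < trueSize z h := fun h => lt_of_lt_of_le (by positivity) (hnα h)
  have hexp : ∀ g, ENNReal.ofReal (Real.exp (-((trueCluster z g).card : ℝ))) ≤
      ENNReal.ofReal (Real.exp (-(n * α))) := fun g =>
    ENNReal.ofReal_le_ofReal (Real.exp_le_exp.2 (neg_le_neg (hnα g)))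
  have h1 := measure_exists_fin_le _ fun g =>
    (hw.measure_exists_norm_sum_sq_ge_le hσ (trueCluster z g)).trans (hexp g)
  have h2 := measure_exists_fin_le _ fun g =>
    (hw.measure_sum_norm_sq_ge_le hσ hd1 (trueCluster z g)).trans (hexp g)
  have h3 := measure_exists_fin_le _ fun h =>
    measure_card_confusing_ge_le (z := z) hw hσ hε' hΔ0 hκ hκ' hΔ hd hn hα hkα hnα h
  have h4 := measure_exists_fin_le _ fun h => measure_exists_fin_le _ fun j =>
    measure_card_coord_le_le (z := z) hw hn h (p h) (by exact_mod_cast hN h) j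
  have h34 := measure_or_le (by positivity) (by positivity) h3 h4
  have h234 := measure_or_le (by positivity) (by positivity) h2 h34
  have h1234 := measure_or_le (by positivity) (by positivity) h1 h234
  obtain ⟨G, hGm, hG, hGω⟩ := exists_measurableSet_forall_not (by positivity) h1234
  refine ⟨G, hGm, hG, fun ω hω => ?_⟩
  have hnot := hGω ω hω
  simp only [not_or, not_exists, not_and, not_le, not_lt] at hnot
  obtain ⟨k1, k2, k3, k4⟩ := hnot
  exact ⟨k1, fun g => (k2 g).le, k3, fun h j hM => k4 h j hM⟩

theorem budget_le {x α κ : ℝ} (hk : 2 ≤ k) (hkn : k ≤ n) (hα : 0 < α)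
    (hlog : 10 * Real.log n ≤ n * α) (hκ : 0 < κ)
    (hx : 5 ≤ κ * x) (hαx : 1 ≤ α * x ^ 2) :
    k * Real.exp (-(n * α)) + (k * Real.exp (-(n * α)) +
        (k * (4 / α * Real.exp (-(κ * x ^ 2))) + k * (d * (2 * ((n : ℝ) ^ 6)⁻¹)))) ≤
      8 * max 1 ((d : ℝ) / (n : ℝ) ^ 4) * (n : ℝ)⁻¹
        + 16 * d * (n : ℝ) ^ 4 * Real.exp (-(0.3 * n))
        + 2 * (k : ℝ) ^ 2 * Real.exp (-(x / 4)) := by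
  have hn1 : (1 : ℝ) ≤ n := by exact_mod_cast (by omega : 1 ≤ n)
  have hn0 : (0 : ℝ) < n := by linarith
  have hkn' : (k : ℝ) ≤ n := by exact_mod_cast hkn
  have hk2 : (2 : ℝ) ≤ k := by exact_mod_cast hk
  have hx0 : 0 < x := by
    by_contra! h
    nlinarith
  set M := max 1 ((d : ℝ) / (n : ℝ) ^ 4) with hM
  have hM1 : 1 ≤ M := le_max_left _ _
  have hMd : (d : ℝ) / (n : ℝ) ^ 4 ≤ M := le_max_right _ _
  have h1 : k * Real.exp (-(n * α)) ≤ M * (n : ℝ)⁻¹ := by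
    have h2 : Real.exp (-(n * α)) ≤ ((n : ℝ) ^ 2)⁻¹ := by
      rw [Real.exp_neg]
      apply inv_anti₀ (by positivity)
      have h3 : (n : ℝ) ^ 10 ≤ Real.exp (n * α) := by
        have : (n : ℝ) ^ 10 = Real.exp ((10 : ℕ) * Real.log n) := by
          rw [Real.exp_nat_mul, Real.exp_log hn0]
        rw [this]
        exact Real.exp_le_exp.2 (by exact_mod_cast hlog)
      exact (pow_le_pow_right₀ hn1 (by norm_num)).trans h3
    calc k * Real.exp (-(n * α)) ≤ n * ((n : ℝ) ^ 2)⁻¹ := by gcongr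
      _ = 1 * (n : ℝ)⁻¹ := by field_simp
      _ ≤ M * (n : ℝ)⁻¹ := by gcongr
  have h4 : k * (d * (2 * ((n : ℝ) ^ 6)⁻¹)) ≤ 2 * M * (n : ℝ)⁻¹ := by
    calc k * (d * (2 * ((n : ℝ) ^ 6)⁻¹)) ≤ n * (d * (2 * ((n : ℝ) ^ 6)⁻¹)) := by gcongr
      _ = 2 * (d / (n : ℝ) ^ 4) * (n : ℝ)⁻¹ := by field_simp
      _ ≤ 2 * M * (n : ℝ)⁻¹ := by gcongr
  -- The factor `1/α ≤ x² ≤ exp(2x)` is absorbed by `exp(-κx²) ≤ exp(-5x)`, and `4k ≤ 2k²`.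
  have h5 : k * (4 / α * Real.exp (-(κ * x ^ 2))) ≤ 2 * (k : ℝ) ^ 2 * Real.exp (-(x / 4)) := by
    have ha : 1 / α ≤ x ^ 2 := by rw [div_le_iff₀ hα]; linarith
    have hx2 : x ^ 2 ≤ Real.exp (2 * x) := by
      have : x ≤ Real.exp x := by linarith [Real.add_one_le_exp x]
      have h6 := pow_le_pow_left₀ hx0.le this 2
      rwa [← Real.exp_nat_mul] at h6
    have h7 : 5 * x ≤ κ * x ^ 2 := by nlinarith
    have h8 : 4 / α * Real.exp (-(κ * x ^ 2)) ≤ 4 * Real.exp (-(x / 4)) := by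
      calc 4 / α * Real.exp (-(κ * x ^ 2)) = 4 * (1 / α * Real.exp (-(κ * x ^ 2))) := by ring
        _ ≤ 4 * (Real.exp (2 * x) * Real.exp (-(5 * x))) := by
          gcongr
          exact ha.trans hx2
        _ = 4 * Real.exp (-(3 * x)) := by rw [← Real.exp_add]; congr 2; ring
        _ ≤ 4 * Real.exp (-(x / 4)) := by gcongr; linarith
    calc k * (4 / α * Real.exp (-(κ * x ^ 2))) ≤ k * (4 * Real.exp (-(x / 4))) := by gcongr
      _ = 2 * k * 2 * Real.exp (-(x / 4)) := by ring
      _ ≤ 2 * k * k * Real.exp (-(x / 4)) := by gcongr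
      _ = _ := by ring
  have h9 : 0 ≤ 16 * d * (n : ℝ) ^ 4 * Real.exp (-(0.3 * n)) := by positivity
  have h10 : 0 ≤ M * (n : ℝ)⁻¹ := by positivity
  linarith

end Good

/-- Multiplied by `N`, the first term of the level cancels the Hoeffding deviation, the second
exceeds `W`, and the third is at least `m/2` because `m ≤ N`. -/
theorem lt_two_mul_of_pLevel {N W m s e l : ℝ} (hN : 0 < N) (hm : 0 ≤ m) (hmN : m ≤ N)
    (hl : 0 ≤ l) (he : 0 ≤ e) (hW : W < N * e)
    (hs : (1 / 2 + (√(3 * l / N) + e + m / (m + N))) * N - √(3 * N * l) < s) :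
    N + W + m < 2 * s := by
  have h1 : √(3 * l / N) * N = √(3 * N * l) := by
    have : 3 * N * l = 3 * l / N * N ^ 2 := by field_simp
    rw [this, Real.sqrt_mul (by positivity), Real.sqrt_sq hN.le]
  have h2 : m / 2 ≤ m / (m + N) * N := by
    rw [div_mul_eq_mul_div, div_le_div_iff₀ (by norm_num) (by positivity)]
    nlinarith
  nlinarith [mul_nonneg hN.le he]

end RobustClustering

/-! ### Assembly of the theorem. -/

theorem mainTheorem2 :
    ∃ c₁ c₂ : ℝ, 0 < c₁ ∧ 0 < c₂ ∧ ∀ τ : ℝ, 0 < τ → ∃ C : ℝ, 0 < C ∧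
      ∀ (Ω : Type*) [MeasurableSpace Ω] (μ : Measure Ω) [IsProbabilityMeasure μ]
        (n k d nout : ℕ) (σ δ : ℝ) (θ : Fin k → EuclideanSpace ℝ (Fin d)) (z : Fin n → Fin k)
        (w : Fin n → Ω → EuclideanSpace ℝ (Fin d)),
        2 ≤ k → 1 ≤ d → 0 < σ → IsSubGaussianNoise μ σ w →
        0 < δ → δ ≤ 1 → (nout : ℝ) = n * minFraction z * (1 - δ) →
        10 * Real.log n ≤ n * minFraction z →
        C ≤ √δ * snr θ σ * √(minFraction z / d) →
        ∃ G : Set Ω, MeasurableSet G ∧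
          1 - 8 * max 1 ((d : ℝ) / (n : ℝ) ^ 4) * (n : ℝ)⁻¹
              - 16 * d * (n : ℝ) ^ 4 * Real.exp (-(0.3 * n))
              - 2 * (k : ℝ) ^ 2 * Real.exp (-(snr θ σ / 4)) ≤ μ.real G ∧
          ∀ ω ∈ G, ∀ (x : Fin nout → EuclideanSpace ℝ (Fin d))
            (lab : ℕ → Fin n ⊕ Fin nout → Fin k) (c : ℕ → Fin k → EuclideanSpace ℝ (Fin d)),
            IsRun (dataset θ z (fun i => w i ω) x) lab c →
            InitCondition c₁ c₂ δ σ θ z (dataset θ z (fun i => w i ω) x) (lab 0) (c 0) →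
            ∀ s : ℕ, 2 ≤ s → ∀ h : Fin k,
              ENNReal.ofReal (‖c s h - θ h‖ ^ 2) ≤
                d * maxQuantile μ w z h (pLevel τ σ nout θ z h) ^ 2 := by
  classical
  refine ⟨32, 1, by norm_num, by norm_num, fun τ hτ => ?_⟩
  obtain ⟨η, hη⟩ : ∃ η, η = 1 / (2 + τ / 4) := ⟨_, rfl⟩
  have hη0 : 0 < η := by rw [hη]; positivity
  have hη2 : η < 1 / 2 := by
    rw [hη]; exact one_div_lt_one_div_of_lt (by norm_num) (by linarith)
  -- The gap `1/2 - η > 0` is shared equally between `κ` and `10ε`, with `ε = κ/10`.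
  obtain ⟨κ, hκ⟩ : ∃ κ, κ = (1 / 2 - η) / 2 := ⟨_, rfl⟩
  have hκ0 : 0 < κ := by linarith
  have hκ4 : κ ≤ 1 / 4 := by linarith
  -- Accuracy `ε Δ` with `ε = κ/10` needs `800 d ≤ κ² δ SNR²`; `κC = 30` supplies `900 d`.
  refine ⟨30 / κ, by positivity, ?_⟩
  intro Ω _ μ _ n k d nout σ δ θ z w hk hd hσ hw hδ hδ1 hnout hlog hC
  have hC0 : 0 < 30 / κ := by positivity
  have hκC : κ * (30 / κ) = 30 := by field_simp
  have hC120 : 120 ≤ 30 / κ := by rw [le_div_iff₀ hκ0]; linarith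
  generalize 30 / κ = C at hC hC0 hκC hC120
  have hd' : (1 : ℝ) ≤ d := by exact_mod_cast hd
  have hprod := hC0.trans_le hC
  have hα : 0 < minFraction z := by
    by_contra! h
    rw [Real.sqrt_eq_zero_of_nonpos (div_nonpos_of_nonpos_of_nonneg h (by positivity)),
      mul_zero] at hprod
    exact lt_irrefl _ hprod
  have hx0 : 0 < snr θ σ := by
    have h1 : 0 < √δ * snr θ σ := pos_of_mul_pos_left hprod (Real.sqrt_nonneg _)
    exact pos_of_mul_pos_right h1 (Real.sqrt_nonneg _)
  have hΔ : 0 < minSeparation θ := by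
    have h1 : minSeparation θ = snr θ σ * (2 * σ) := by rw [snr]; field_simp
    rw [h1]; positivity
  have hn := pos_of_minFraction_pos hk hα
  have hn' : (0 : ℝ) < n := by exact_mod_cast hn
  have hnα := fun h => mul_minFraction_le (z := z) hn h
  have hkα := card_mul_minFraction_le_one (z := z) hn
  have hk' : (2 : ℝ) ≤ k := by exact_mod_cast hk
  have hα1 : minFraction z ≤ 1 := by nlinarith
  have hN : ∀ h, (0 : ℝ) < trueSize z h := fun h => lt_of_lt_of_le (by positivity) (hnα h)
  have hkn : k ≤ n := by
    have h1 := Finset.card_nsmul_le_sum (Finset.univ : Finset (Fin k)) (fun g => trueSize z g) 1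
      fun g _ => by exact_mod_cast hN g
    rw [sum_trueSize] at h1
    simpa using h1
  have hCd := sq_mul_le_of_le_mul_sqrt hC0 hδ hd hα.le hC
  have hC2 : 120 ^ 2 ≤ C ^ 2 := pow_le_pow_left₀ (by norm_num) hC120 2
  have hx2 : 0 < snr θ σ ^ 2 := by positivity
  have hαδ : minFraction z * δ * snr θ σ ^ 2 ≤ minFraction z * snr θ σ ^ 2 := by
    have := mul_le_mul_of_nonneg_left hδ1 (mul_nonneg hα.le hx2.le)
    linarith
  have hαδ' : minFraction z * δ * snr θ σ ^ 2 ≤ δ * snr θ σ ^ 2 := by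
    have := mul_le_mul_of_nonneg_right hα1 (mul_nonneg hδ.le hx2.le)
    linarith
  have hαx : minFraction z * snr θ σ ^ 2 ≤ snr θ σ ^ 2 := by
    have := mul_le_mul_of_nonneg_right hα1 hx2.le
    linarith
  have hCd0 : 120 ^ 2 * (d : ℝ) ≤ C ^ 2 * d := mul_le_mul_of_nonneg_right hC2 (by positivity)
  have hCx : C ≤ snr θ σ := by
    refine (sq_le_sq₀ hC0.le hx0.le).1 ?_
    have := mul_le_mul_of_nonneg_left hd' (sq_nonneg C)
    linarith
  have hD : 1 + (d : ℝ) * k / n ≤ 2 * d := by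
    have h1 : (k : ℝ) / n ≤ 1 := by rw [div_le_one hn']; exact_mod_cast hkn
    have h2 := mul_le_mul_of_nonneg_left h1 (show (0 : ℝ) ≤ d by positivity)
    rw [mul_div_assoc]
    linarith
  have hxΔ : minSeparation θ = 2 * σ * snr θ σ := by rw [snr]; field_simp
  have hsep : ∀ g h, g ≠ h → minSeparation θ ≤ ‖θ g - θ h‖ := fun g h hgh => minSeparation_le θ hgh
  obtain ⟨G, hGm, hG, hGω⟩ := exists_good_event (z := z) hw hσ hd (ε := κ / 10) (η := η) (κ := κ)
    (by linarith) hΔ (by linarith) (by linarith) hsep (by rw [← snr]; linarith) hn hα hkα hnα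
    (pLevel τ σ nout θ z)
  rw [← snr] at hG
  refine ⟨G, hGm, ?_, fun ω hω x lab c hrun hinit s hs h => ?_⟩
  · have := budget_le (d := d) hk hkn hα hlog hκ0
      (by linarith [mul_le_mul_of_nonneg_left hCx hκ0.le]) (x := snr θ σ) (by linarith)
    linarith
  obtain ⟨hE1, hE2, hE3, hE4⟩ := hGω ω hω
  -- An infinite quantile makes the bound trivial, but only because `d ≠ 0`: in `ℝ≥0∞`, `0 * ⊤ = 0`.
  by_cases hM : maxQuantile μ w z h (pLevel τ σ nout θ z h) = ⊤
  · rw [hM]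
    have : (d : ℝ≥0∞) ≠ 0 := by exact_mod_cast (by omega : d ≠ 0)
    simp [ENNReal.mul_top this]
  obtain ⟨L, r, hL, hr, hLr, hrσ⟩ := exists_radius_of_initCondition hinit hE2 hσ hδ hd hn hα hα1 hΔ
    (by linarith)
  have hnear := norm_sub_le_of_isRun hE1 hE2 hrun hL hr hLr hΔ hsep hn hα hδ hkα hnα
    (by linarith) hδ1 hrσ
    (by
      rw [hxΔ]
      have h1 : 192 * (1 + (d : ℝ) * k / n) ≤ minFraction z * δ * snr θ σ ^ 2 := by linarith
      have := mul_le_mul_of_nonneg_left h1 (show 0 ≤ 4 * σ ^ 2 by positivity)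
      linarith)
    (ε := κ / 10) (by positivity) (by linarith)
    (by
      rw [hxΔ]
      have h1 : κ ^ 2 * (C ^ 2 * d) ≤ κ ^ 2 * (δ * snr θ σ ^ 2) :=
        mul_le_mul_of_nonneg_left (hCd.trans hαδ') (sq_nonneg κ)
      have h2 : κ ^ 2 * (C ^ 2 * d) = 900 * d := by rw [← mul_assoc, ← mul_pow, hκC]; norm_num
      rw [h2] at h1
      have := mul_le_mul_of_nonneg_left h1 (show 0 ≤ σ ^ 2 / 25 by positivity)
      have h3 : 0 ≤ σ ^ 2 * d := by positivity
      linarith)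
  -- The centers are accurate from index `1`, hence the labels they produce are good from index `2`.
  obtain ⟨t, rfl⟩ : ∃ t, s = t + 1 + 1 := ⟨s - 2, by omega⟩
  have hW : ((mislabelled z (lab (t + 1 + 1)) h).card : ℝ) <
      trueSize z h * Real.exp (-(1 / (2 + τ / 4)) * snr θ σ ^ 2) := by
    refine lt_of_le_of_lt (Nat.cast_le.2 (card_mislabelled_le_card_confusing
      (hrun.assign (t + 1)) (hnear t) hsep (by positivity) (by linarith) h)) ?_
    rw [neg_mul, ← hη]
    exact hE3 h
  have hnN : (nout : ℝ) ≤ trueSize z h := by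
    have h1 : 0 ≤ n * minFraction z * δ := by positivity
    linarith [hnα h]
  have hlog0 : 0 ≤ Real.log n := Real.log_nonneg (by exact_mod_cast hn)
  have hfin := norm_sub_sq_le_of_isCoordMedian (θ := θ) (z := z) (w := fun i => w i ω) (x := x)
    (hrun.update (t + 1) h) (Q := (maxQuantile μ w z h (pLevel τ σ nout θ z h)).toReal)
    (fun j => by
      exact_mod_cast lt_two_mul_of_pLevel (hN h) (Nat.cast_nonneg nout) hnN hlog0
        (Real.exp_pos _).le hW (hE4 h j hM).1)
    (fun j => by
      exact_mod_cast lt_two_mul_of_pLevel (hN h) (Nat.cast_nonneg nout) hnN hlog0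
        (Real.exp_pos _).le hW (hE4 h j hM).2)
  refine (ENNReal.ofReal_le_ofReal hfin).trans_eq ?_
  rw [ENNReal.ofReal_mul (by positivity), ENNReal.ofReal_natCast,
    ENNReal.ofReal_pow ENNReal.toReal_nonneg, ENNReal.ofReal_toReal hM]
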